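/- **Theorem (symmetry of the LSD of random commutator matrices).** For each $n$ let $p=p(n)$ and let $Z_1=Z_1^{(n)}$, $Z_2=Z_2^{(n)}$ be random complex $p\times n$ matrices with entries $z^{(k)}_{ij}$. Let $\Sigma_{1n},\Sigma_{2n}$ be random positive semi-definite $p\times p$ complex matrices such that the pair $(\Sigma_{1n},\Sigma_{2n})$ is independent of the pair $(Z_1,Z_2)$. Put $$S_n=\frac1n\left(X_1X_2^*-X_2X_1^*\right),\qquad X_k=\Sigma_{kn}^{1/2}Z_k .$$ Assume: 1. $p/n\to c\in(0,\infty)$. 2. For each $n$, the entries of $Z_1$ and $Z_2$ are jointly independent, with $\mathbb E z^{(k)}_{ij}=0$ and $\mathbb E|z^{(k)}_{ij}|^2=1$, and for some $\eta_0>0$, $\sup_{n,k,i,j}\mathbb E|z^{(k)}_{ij}|^{2+\eta_0}<\infty$. 3. Almost surely, $\Sigma_{1n}\Sigma_{2n}=\Sigma_{2n}\Sigma_{1n}$ for all $n$. 4. Let $H_n=\frac1p\sum_{j=1}^p\delta_{(\lambda^{(1)}_j,\lambda^{(2)}_j)}$ be the joint empirical spectral distribution of $(\Sigma_{1n},\Sigma_{2n})$,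 where $\Sigma_{kn}=P\,\mathrm{diag}(\lambda^{(k)}_1,\dots,\lambda^{(k)}_p)P^*$ for a common unitary $P$. Almost surely $H_n$ converges weakly to a non-random probability measure $H$ on $[0,\infty)^2$ whose support is contained in neither of the two coordinate axes. 5. There is a constant $D_0>0$ such that, almost surely, $\limsup_{n\to\infty}\frac1p\operatorname{trace}(\Sigma_{kn}^2)<D_0$ for $k=1,2$. Let $F$ be the limiting spectral distribution (LSD) of $S_n$, i.e. the non-random probability measure (carried by the imaginary axis) to which, almost surely, the empirical spectral distribution of $S_n$ (mass $1/p$ at each eigenvalue, counted with multiplicity) converges weakly. Then $F$ is symmetric about $0$: $F(-B)=F(B)$ for every Borel set $B$. -/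

import Mathlib

open MeasureTheory ProbabilityTheory Filter Topology
open scoped NNReal ENNReal Matrix ComplexOrder

namespace RandomCommutator

/-- The probability measure giving equal mass to the entries of a finite multiset, counted with
multiplicity (the zero measure for the empty multiset). -/
noncomputable def empiricalMeasure {E : Type*} [MeasurableSpace E] (s : Multiset E) :
    FiniteMeasure E :=
  (s.card : ℝ≥0)⁻¹ • (s.map fun x => (diracProba x).toFiniteMeasure).sum

/-- Empirical spectral distribution of a square complex matrix: equal mass on each eigenvalue,
counted with algebraic multiplicity. It lives on `ℂ`; for a skew-Hermitian matrix it is carried by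
the imaginary axis. -/
noncomputable def esd {p : ℕ} (A : Matrix (Fin p) (Fin p) ℂ) : FiniteMeasure ℂ :=
  empiricalMeasure A.charpoly.roots

/-- `P` is a unitary matrix with `M₁ = P diag(d₁) P*` and `M₂ = P diag(d₂) P*`, the `d`s real. -/
def IsJointDiagonalization {p : ℕ} (M₁ M₂ P : Matrix (Fin p) (Fin p) ℂ) (d₁ d₂ : Fin p → ℝ) :
    Prop :=
  P ∈ Matrix.unitaryGroup (Fin p) ℂ ∧
    M₁ = P * Matrix.diagonal (fun j => (d₁ j : ℂ)) * Pᴴ ∧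
    M₂ = P * Matrix.diagonal (fun j => (d₂ j : ℂ)) * Pᴴ

open Classical in
/-- Joint empirical spectral distribution of two commuting Hermitian matrices: choose a common
unitary diagonalization and give equal mass to the pairs `(d₁ j, d₂ j)`. (Junk value `0` if there
is no common diagonalization.) It does not depend on the choice, see `jesd_eq`. -/
noncomputable def jesd {p : ℕ} (M₁ M₂ : Matrix (Fin p) (Fin p) ℂ) : FiniteMeasure (ℝ × ℝ) :=
  if h : ∃ D : Matrix (Fin p) (Fin p) ℂ × (Fin p → ℝ) × (Fin p → ℝ),
      IsJointDiagonalization M₁ M₂ D.1 D.2.1 D.2.2 then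
    empiricalMeasure (Finset.univ.val.map fun j => (h.choose.2.1 j, h.choose.2.2 j))
  else 0

theorem diag_intertwine {p : ℕ} {P Q : Matrix (Fin p) (Fin p) ℂ} {d e : Fin p → ℝ}
    (hP : P ∈ Matrix.unitaryGroup (Fin p) ℂ) (hQ : Q ∈ Matrix.unitaryGroup (Fin p) ℂ)
    (h : P * Matrix.diagonal (fun j => (d j : ℂ)) * Pᴴ
      = Q * Matrix.diagonal (fun j => (e j : ℂ)) * Qᴴ)
    {i j : Fin p} (hij : (Qᴴ * P) i j ≠ 0) : d j = e i := by
  have hP' : Pᴴ * P = 1 := Matrix.mem_unitaryGroup_iff'.1 hP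
  have hQ' : Qᴴ * Q = 1 := Matrix.mem_unitaryGroup_iff'.1 hQ
  have h2 : (Qᴴ * P) * Matrix.diagonal (fun j => (d j : ℂ))
      = Matrix.diagonal (fun j => (e j : ℂ)) * (Qᴴ * P) := by
    calc (Qᴴ * P) * Matrix.diagonal (fun j => (d j : ℂ))
        = Qᴴ * (P * Matrix.diagonal (fun j => (d j : ℂ)) * Pᴴ) * P := by
          simp only [Matrix.mul_assoc, hP', Matrix.mul_one]
      _ = (Qᴴ * Q) * Matrix.diagonal (fun j => (e j : ℂ)) * (Qᴴ * P) := by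
          rw [h]; simp only [Matrix.mul_assoc]
      _ = _ := by rw [hQ', Matrix.one_mul]
  have h3 := congrFun (congrFun h2 i) j
  rw [Matrix.mul_diagonal, Matrix.diagonal_mul, mul_comm] at h3
  exact_mod_cast mul_right_cancel₀ hij h3

theorem jointDiag_unique {p : ℕ} {M₁ M₂ P Q : Matrix (Fin p) (Fin p) ℂ}
    {d₁ d₂ e₁ e₂ : Fin p → ℝ} (hP : IsJointDiagonalization M₁ M₂ P d₁ d₂)
    (hQ : IsJointDiagonalization M₁ M₂ Q e₁ e₂) :
    (Finset.univ.val.map fun j => (d₁ j, d₂ j)) =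
      (Finset.univ.val.map fun j => (e₁ j, e₂ j)) := by
  have hu : Qᴴ * P ∈ Matrix.unitaryGroup (Fin p) ℂ :=
    mul_mem (Unitary.star_mem hQ.1) hP.1
  have hdet : (Qᴴ * P).det ≠ 0 := by
    intro h0
    have := congrArg Matrix.det (Matrix.mem_unitaryGroup_iff.1 hu)
    rw [Matrix.det_mul, h0, zero_mul, Matrix.det_one] at this
    exact zero_ne_one this
  rw [Matrix.det_apply] at hdet
  obtain ⟨σ, -, hσ⟩ := Finset.exists_ne_zero_of_sum_ne_zero hdet
  have hprod : ∏ i, (Qᴴ * P) (σ i) i ≠ 0 := fun h => hσ (by rw [h, smul_zero])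
  have hent : ∀ i, (Qᴴ * P) (σ i) i ≠ 0 := fun i => Finset.prod_ne_zero_iff.1 hprod i (by simp)
  have hfun : (fun j => (d₁ j, d₂ j)) = (fun j => (e₁ j, e₂ j)) ∘ σ := by
    funext j
    exact Prod.ext (diag_intertwine hP.1 hQ.1 (hP.2.1.symm.trans hQ.2.1) (hent j))
      (diag_intertwine hP.1 hQ.1 (hP.2.2.symm.trans hQ.2.2) (hent j))
  rw [hfun]
  rw [← Multiset.map_map, Multiset.map_univ_val_equiv]

/-- The joint empirical spectral distribution may be computed in any common diagonalization. -/
theorem jesd_eq {p : ℕ} {M₁ M₂ P : Matrix (Fin p) (Fin p) ℂ} {d₁ d₂ : Fin p → ℝ}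
    (h : IsJointDiagonalization M₁ M₂ P d₁ d₂) :
    jesd M₁ M₂ = empiricalMeasure (Finset.univ.val.map fun j => (d₁ j, d₂ j)) := by
  have hex : ∃ D : Matrix (Fin p) (Fin p) ℂ × (Fin p → ℝ) × (Fin p → ℝ),
      IsJointDiagonalization M₁ M₂ D.1 D.2.1 D.2.2 := ⟨(P, d₁, d₂), h⟩
  rw [jesd, dif_pos hex, jointDiag_unique hex.choose_spec h]

open scoped MatrixOrder in
/-- The positive semi-definite square root of a positive semi-definite matrix. -/
noncomputable def psdSqrt {p : ℕ} (A : Matrix (Fin p) (Fin p) ℂ) : Matrix (Fin p) (Fin p) ℂ :=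
  CFC.sqrt A

/-- The commutator matrix `n⁻¹ (X₁ X₂* - X₂ X₁*)` with `X_k = Σ_k^{1/2} Z_k`; the index `0` plays
the role of `k = 1` and the index `1` that of `k = 2`. -/
noncomputable def commutatorMatrix {p n : ℕ} (S : Fin 2 → Matrix (Fin p) (Fin p) ℂ)
    (Z : Fin 2 → Matrix (Fin p) (Fin n) ℂ) : Matrix (Fin p) (Fin p) ℂ :=
  (n : ℂ)⁻¹ • ((psdSqrt (S 0) * Z 0) * (psdSqrt (S 1) * Z 1)ᴴ
    - (psdSqrt (S 1) * Z 1) * (psdSqrt (S 0) * Z 0)ᴴ)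

/-- The probability measure `F` is the limiting spectral distribution of the random matrices `A n`:
almost surely, their empirical spectral distributions converge weakly to `F`. -/
def IsLSD {Ω : Type*} [MeasurableSpace Ω] (μ : Measure Ω) {p : ℕ → ℕ}
    (A : (n : ℕ) → Ω → Matrix (Fin (p n)) (Fin (p n)) ℂ) (F : ProbabilityMeasure ℂ) : Prop :=
  ∀ᵐ ω ∂μ, Tendsto (fun n => esd (A n ω)) atTop (𝓝 F.toFiniteMeasure)

end RandomCommutator

/-!
Replacing `Z₂` by `-Z₂` turns `S_n` into `-S_n`, so were the entries of `Z₂` symmetric the law of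
`S_n` would be even. In general the expected normalized trace of `(1 - s S_n)⁻¹` changes only by
`o(1)` when the signs of the columns of `Z₂` are flipped entry by entry: each flip alters `S_n` by a
matrix of rank two depending linearly on the entry, the first-order term vanishes in expectation as
the entry is centred, and the remainder is controlled by its `2 + η₀` moment (Lindeberg's argument).
Hence the transform `s ↦ ∫ (1 - s z)⁻¹ dF(z)` is even, and this transform determines `F`.
-/

namespace RandomCommutator

section Resolvent

open Matrix
open scoped Matrix.Norms.L2Operator

/-- The resolvent `(1 - z)⁻¹` at the point `z = y i` of the imaginary axis, as a function of `y`.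
Its dilates `y ↦ resolventKernel (s * y)` determine a probability measure on `ℝ`, and their
integrals against the empirical spectral distribution of a skew-Hermitian matrix are traces of
resolvents. -/
noncomputable def resolventKernel (y : ℝ) : ℂ := (1 - y * Complex.I)⁻¹

theorem one_sub_ofReal_mul_I_ne_zero (y : ℝ) : (1 : ℂ) - y * Complex.I ≠ 0 :=
  fun h => by simpa using congrArg Complex.re h

theorem norm_resolventKernel_le_one (y : ℝ) : ‖resolventKernel y‖ ≤ 1 := by
  rw [resolventKernel, norm_inv]
  exact inv_le_one_of_one_le₀ (by simpa using Complex.abs_re_le_norm (1 - y * Complex.I))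

theorem continuous_resolventKernel : Continuous resolventKernel :=
  Continuous.inv₀ (by fun_prop) one_sub_ofReal_mul_I_ne_zero

variable {m : Type*} [Fintype m] [DecidableEq m] {A D : Matrix m m ℂ}

theorem exists_eq_conj_diagonal (hA : A ∈ skewAdjoint (Matrix m m ℂ)) :
    ∃ (U : unitary (Matrix m m ℂ)) (d : m → ℝ),
      A = Unitary.conjStarAlgAut ℂ _ U (diagonal fun i => (d i : ℂ) * Complex.I) := by
  have hH : ((-Complex.I) • A).IsHermitian := by
    simp [IsHermitian, ← star_eq_conjTranspose, skewAdjoint.mem_iff.1 hA]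
  refine ⟨hH.eigenvectorUnitary, hH.eigenvalues, ?_⟩
  calc A = Complex.I • (-Complex.I) • A := by simp [smul_smul]
    _ = _ := congrArg (Complex.I • ·) hH.spectral_theorem
    _ = _ := by
      rw [← map_smul, ← diagonal_smul]
      exact congrArg _ (congrArg _ (funext fun i => mul_comm _ _))

theorem one_sub_conj_diagonal_mul (U : unitary (Matrix m m ℂ)) (d : m → ℝ) :
    (1 - Unitary.conjStarAlgAut ℂ _ U (diagonal fun i => (d i : ℂ) * Complex.I))
      * Unitary.conjStarAlgAut ℂ _ U (diagonal fun i => resolventKernel (d i)) = 1 := by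
  have h : (1 - diagonal fun i => (d i : ℂ) * Complex.I) * diagonal (fun i => resolventKernel (d i))
      = (1 : Matrix m m ℂ) := by
    rw [← diagonal_one, diagonal_sub, diagonal_mul_diagonal]
    exact congrArg diagonal (funext fun i => mul_inv_cancel₀ (one_sub_ofReal_mul_I_ne_zero _))
  rw [← map_one (Unitary.conjStarAlgAut ℂ (Matrix m m ℂ) U), ← map_sub, ← map_mul, h]

theorem isUnit_one_sub (hA : A ∈ skewAdjoint (Matrix m m ℂ)) : IsUnit (1 - A).det := by
  obtain ⟨U, d, rfl⟩ := exists_eq_conj_diagonal hA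
  exact isUnit_det_of_right_inverse (one_sub_conj_diagonal_mul U d)

theorem norm_inv_one_sub_le_one (hA : A ∈ skewAdjoint (Matrix m m ℂ)) : ‖(1 - A)⁻¹‖ ≤ 1 := by
  obtain ⟨U, d, rfl⟩ := exists_eq_conj_diagonal hA
  rw [inv_eq_right_inv (one_sub_conj_diagonal_mul U d), Unitary.conjStarAlgAut_apply,
    ← Unitary.coe_star, CStarRing.norm_mul_coe_unitary, CStarRing.norm_coe_unitary_mul,
    l2_opNorm_diagonal, pi_norm_le_iff_of_nonneg zero_le_one]
  exact fun i => norm_resolventKernel_le_one (d i)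

theorem roots_charpoly_conj_diagonal (U : unitary (Matrix m m ℂ)) (d : m → ℂ) :
    (Unitary.conjStarAlgAut ℂ _ U (diagonal d)).charpoly.roots = Finset.univ.val.map d := by
  rw [Unitary.conjStarAlgAut_apply, charpoly_mul_comm, ← Matrix.mul_assoc,
    Unitary.coe_star_mul_self, Matrix.one_mul, charpoly_diagonal]
  exact (congrArg Polynomial.roots (by rw [Multiset.map_map]; rfl)).trans
    (Polynomial.roots_multiset_prod_X_sub_C _)

theorem trace_conj (U : unitary (Matrix m m ℂ)) (M : Matrix m m ℂ) :
    (Unitary.conjStarAlgAut ℂ _ U M).trace = M.trace := by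
  rw [Unitary.conjStarAlgAut_apply, trace_mul_comm, ← Matrix.mul_assoc,
    Unitary.coe_star_mul_self, Matrix.one_mul]

theorem resolvent_sub_resolvent {R : Type*} [Ring R] {a d g u v : R} (hg : g * (1 - a) = 1)
    (hu : (1 - (a + d)) * u = 1) (hv : (1 - (a - d)) * v = 1) :
    u - v = g * d * (u + v) ∧ u - v = 2 * (g * d * g) + g * d * g * d * (u - v) := by
  have eu : u = g + g * d * u := by
    calc u = g * (1 - a) * u := by rw [hg, one_mul]
      _ = g * ((1 - (a + d)) * u) + g * d * u := by noncomm_ring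
      _ = g + g * d * u := by rw [hu, mul_one]
  have ev : v = g - g * d * v := by
    calc v = g * (1 - a) * v := by rw [hg, one_mul]
      _ = g * ((1 - (a - d)) * v) - g * d * v := by noncomm_ring
      _ = g - g * d * v := by rw [hv, mul_one]
  have first : u - v = g * d * (u + v) := by
    nth_rewrite 1 [eu, ev]; noncomm_ring
  have second : u + v = 2 * g + g * d * (u - v) := by
    nth_rewrite 1 [eu, ev]; noncomm_ring
  refine ⟨first, ?_⟩
  nth_rewrite 1 [first]
  rw [second]
  noncomm_ring

variable (A) in
/-- The normalized trace of the resolvent of `A` at `1`. -/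
noncomputable def resolventTrace : ℂ := (Fintype.card m : ℂ)⁻¹ * ((1 - A)⁻¹).trace

theorem resolventTrace_conj_diagonal (U : unitary (Matrix m m ℂ)) (d : m → ℝ) :
    resolventTrace (Unitary.conjStarAlgAut ℂ _ U (diagonal fun i => (d i : ℂ) * Complex.I))
      = (Fintype.card m : ℂ)⁻¹ * ∑ i, resolventKernel (d i) := by
  rw [resolventTrace, inv_eq_right_inv (one_sub_conj_diagonal_mul U d), trace_conj, trace_diagonal]

theorem norm_resolventTrace_le_one (hA : A ∈ skewAdjoint (Matrix m m ℂ)) :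
    ‖resolventTrace A‖ ≤ 1 := by
  obtain ⟨U, d, rfl⟩ := exists_eq_conj_diagonal hA
  rw [resolventTrace_conj_diagonal, norm_mul, norm_inv, Complex.norm_natCast]
  calc _ ≤ (Fintype.card m : ℝ)⁻¹ * ∑ _i : m, 1 := by
        gcongr
        exact norm_sum_le_of_le _ fun i _ => norm_resolventKernel_le_one (d i)
    _ ≤ 1 := by simpa using inv_mul_le_one

theorem norm_vecMulVec_star (x a : EuclideanSpace ℂ m) :
    ‖vecMulVec x.ofLp (star a.ofLp)‖ = ‖x‖ * ‖a‖ := by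
  have h : toEuclideanCLM (𝕜 := ℂ) (vecMulVec x.ofLp (star a.ofLp))
      = InnerProductSpace.rankOne ℂ x a := by
    ext v i
    simp [vecMulVec_mulVec, EuclideanSpace.inner_eq_star_dotProduct, dotProduct_comm v.ofLp,
      mul_comm (x.ofLp i)]
  rw [cstar_norm_def, h, InnerProductSpace.norm_rankOne]

theorem norm_trace_vecMulVec_star_mul_le (x a : EuclideanSpace ℂ m) (M : Matrix m m ℂ) :
    ‖(vecMulVec x.ofLp (star a.ofLp) * M).trace‖ ≤ ‖x‖ * ‖a‖ * ‖M‖ := by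
  have h : (vecMulVec x.ofLp (star a.ofLp) * M).trace
      = inner ℂ a (WithLp.toLp 2 (M *ᵥ x.ofLp)) := by
    rw [trace_mul_comm, mul_vecMulVec, trace_vecMulVec, EuclideanSpace.inner_eq_star_dotProduct]
  calc ‖(vecMulVec x.ofLp (star a.ofLp) * M).trace‖
      ≤ ‖a‖ * ‖WithLp.toLp 2 (M *ᵥ x.ofLp)‖ := h ▸ norm_inner_le_norm _ _
    _ ≤ ‖a‖ * (‖M‖ * ‖x‖) := by gcongr; exact l2_opNorm_mulVec M x
    _ = ‖x‖ * ‖a‖ * ‖M‖ := by ring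

/-- The skew-adjoint matrix of rank at most two by which a single entry `t` of `Y` contributes to
`X * Yᴴ - Y * Xᴴ`, as a real-linear function of `t`; here `x` is a column of `X`. -/
noncomputable def rankTwo {m : Type*} (x a : EuclideanSpace ℂ m) : ℂ →ₗ[ℝ] Matrix m m ℂ where
  toFun t := star t • vecMulVec x.ofLp (star a.ofLp) - t • vecMulVec a.ofLp (star x.ofLp)
  map_add' s t := by rw [star_add, add_smul, add_smul]; abel
  map_smul' c t := by
    rw [star_smul, star_trivial, smul_assoc, smul_assoc, ← smul_sub, RingHom.id_apply]

omit [Fintype m] [DecidableEq m] in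
theorem rankTwo_mem_skewAdjoint (x a : EuclideanSpace ℂ m) (t : ℂ) :
    rankTwo x a t ∈ skewAdjoint (Matrix m m ℂ) := by
  simp [skewAdjoint.mem_iff, star_eq_conjTranspose, rankTwo, conjTranspose_vecMulVec]

theorem norm_rankTwo_le (x a : EuclideanSpace ℂ m) (t : ℂ) :
    ‖rankTwo x a t‖ ≤ 2 * ‖t‖ * ‖x‖ * ‖a‖ := by
  calc ‖rankTwo x a t‖ ≤ ‖t‖ * (‖x‖ * ‖a‖) + ‖t‖ * (‖a‖ * ‖x‖) :=
        norm_sub_le_of_le (by rw [norm_smul, norm_star, norm_vecMulVec_star])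
          (by rw [norm_smul, norm_vecMulVec_star])
    _ = 2 * ‖t‖ * ‖x‖ * ‖a‖ := by ring

theorem norm_trace_rankTwo_mul_le (x a : EuclideanSpace ℂ m) (t : ℂ) (M : Matrix m m ℂ) :
    ‖(rankTwo x a t * M).trace‖ ≤ 2 * ‖t‖ * ‖x‖ * ‖a‖ * ‖M‖ := by
  have expand : (rankTwo x a t * M).trace
      = star t * (vecMulVec x.ofLp (star a.ofLp) * M).trace
        - t * (vecMulVec a.ofLp (star x.ofLp) * M).trace := by
    simp [rankTwo, sub_mul, trace_sub, trace_smul]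
  calc ‖(rankTwo x a t * M).trace‖ ≤ ‖t‖ * (‖x‖ * ‖a‖ * ‖M‖) + ‖t‖ * (‖a‖ * ‖x‖ * ‖M‖) := by
        rw [expand]
        refine norm_sub_le_of_le ?_ ?_
        · rw [norm_mul, norm_star]; gcongr; exact norm_trace_vecMulVec_star_mul_le x a M
        · rw [norm_mul]; gcongr; exact norm_trace_vecMulVec_star_mul_le a x M
    _ = 2 * ‖t‖ * ‖x‖ * ‖a‖ * ‖M‖ := by ring

theorem resolvent_sub_resolvent_of_mem_skewAdjoint (hA : A ∈ skewAdjoint (Matrix m m ℂ))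
    (hD : D ∈ skewAdjoint (Matrix m m ℂ)) :
    (1 - (A + D))⁻¹ - (1 - (A - D))⁻¹
        = (1 - A)⁻¹ * D * ((1 - (A + D))⁻¹ + (1 - (A - D))⁻¹) ∧
      (1 - (A + D))⁻¹ - (1 - (A - D))⁻¹ = 2 * ((1 - A)⁻¹ * D * (1 - A)⁻¹)
        + (1 - A)⁻¹ * D * (1 - A)⁻¹ * D * ((1 - (A + D))⁻¹ - (1 - (A - D))⁻¹) :=
  resolvent_sub_resolvent (nonsing_inv_mul _ (isUnit_one_sub hA))
    (mul_nonsing_inv _ (isUnit_one_sub (add_mem hA hD)))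
    (mul_nonsing_inv _ (isUnit_one_sub (sub_mem hA hD)))

theorem norm_resolvent_sub_resolvent_le (hA : A ∈ skewAdjoint (Matrix m m ℂ))
    (hD : D ∈ skewAdjoint (Matrix m m ℂ)) :
    ‖(1 - (A + D))⁻¹ - (1 - (A - D))⁻¹‖ ≤ 2 * min 1 ‖D‖ := by
  have hu := norm_inv_one_sub_le_one (add_mem hA hD)
  have hv := norm_inv_one_sub_le_one (sub_mem hA hD)
  rw [mul_min_of_nonneg _ _ zero_le_two]
  refine le_min ((norm_sub_le _ _).trans (by linarith)) ?_
  rw [(resolvent_sub_resolvent_of_mem_skewAdjoint hA hD).1]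
  calc _ ≤ ‖(1 - A)⁻¹‖ * ‖D‖ * ‖(1 - (A + D))⁻¹ + (1 - (A - D))⁻¹‖ := norm_mul₃_le
    _ ≤ 1 * ‖D‖ * (1 + 1) := by
        gcongr
        · exact norm_inv_one_sub_le_one hA
        · exact norm_add_le_of_le hu hv
    _ = 2 * ‖D‖ := by ring

theorem norm_resolvent_remainder_le (hA : A ∈ skewAdjoint (Matrix m m ℂ))
    (hD : D ∈ skewAdjoint (Matrix m m ℂ)) {δ : ℝ} (hDδ : ‖D‖ ≤ δ) :
    ‖(1 - A)⁻¹ * D * ((1 - (A + D))⁻¹ - (1 - (A - D))⁻¹) * (1 - A)⁻¹‖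
      ≤ δ * (2 * min 1 δ) := by
  calc _ ≤ ‖(1 - A)⁻¹‖ * ‖D‖ * ‖(1 - (A + D))⁻¹ - (1 - (A - D))⁻¹‖ * ‖(1 - A)⁻¹‖ :=
        (norm_mul_le _ _).trans (by gcongr; exact norm_mul₃_le)
    _ ≤ 1 * δ * (2 * min 1 δ) * 1 := by
        have hδ := (norm_nonneg D).trans hDδ
        have hg := norm_inv_one_sub_le_one hA
        gcongr
        exact (norm_resolvent_sub_resolvent_le hA hD).trans (by gcongr)
    _ = δ * (2 * min 1 δ) := by ring

theorem trace_resolvent_sub_resolvent (hA : A ∈ skewAdjoint (Matrix m m ℂ))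
    (hD : D ∈ skewAdjoint (Matrix m m ℂ)) :
    (1 - (A + D))⁻¹.trace - (1 - (A - D))⁻¹.trace - 2 * ((1 - A)⁻¹ * D * (1 - A)⁻¹).trace
      = (D * ((1 - A)⁻¹ * D * ((1 - (A + D))⁻¹ - (1 - (A - D))⁻¹) * (1 - A)⁻¹)).trace := by
  have h := congrArg trace (resolvent_sub_resolvent_of_mem_skewAdjoint hA hD).2
  rw [trace_add, two_mul, trace_add, ← two_mul, trace_sub] at h
  rw [h, add_sub_cancel_left]
  simpa only [Matrix.mul_assoc] using
    trace_mul_comm (1 - A)⁻¹ (D * ((1 - A)⁻¹ * (D * ((1 - (A + D))⁻¹ - (1 - (A - D))⁻¹))))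

theorem mul_mul_min_one_le_rpow {δ r : ℝ} (hδ : 0 ≤ δ) (hr : r ∈ Set.Icc 2 3) :
    δ * (δ * min 1 δ) ≤ δ ^ r := by
  rcases le_total δ 1 with h | h
  · calc δ * (δ * min 1 δ) = δ ^ (3 : ℝ) := by rw [min_eq_right h]; norm_cast; ring
      _ ≤ δ ^ r := Real.rpow_le_rpow_of_exponent_ge_of_imp hδ h hr.2 fun _ h0 => by
          linarith [hr.1]
  · calc δ * (δ * min 1 δ) = δ ^ (2 : ℝ) := by rw [min_eq_left h]; norm_cast; ring
      _ ≤ δ ^ r := Real.rpow_le_rpow_of_exponent_le h hr.1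

theorem exists_linear_approx_resolventTrace (hA : A ∈ skewAdjoint (Matrix m m ℂ))
    (x a : EuclideanSpace ℂ m) {r : ℝ} (hr : r ∈ Set.Icc 2 3) :
    ∃ ℓ : ℂ →ₗ[ℝ] ℂ, ∀ t : ℂ,
      ‖resolventTrace (A + rankTwo x a t) - resolventTrace (A + rankTwo x a (-t)) - ℓ t‖
        ≤ (Fintype.card m : ℝ)⁻¹ * (2 * (2 * ‖t‖ * ‖x‖ * ‖a‖) ^ r) := by
  set g := (1 - A)⁻¹
  refine ⟨(traceLinearMap m ℝ ℂ).comp ((LinearMap.mulLeftRight ℝ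
    (((Fintype.card m : ℂ)⁻¹ * 2) • g, g)).comp (rankTwo x a)), fun t => ?_⟩
  set D := rankTwo x a t
  set δ := 2 * ‖t‖ * ‖x‖ * ‖a‖
  have hDskew : D ∈ skewAdjoint (Matrix m m ℂ) := rankTwo_mem_skewAdjoint x a t
  have difference : resolventTrace (A + D) - resolventTrace (A + rankTwo x a (-t))
      - (((Fintype.card m : ℂ)⁻¹ * 2) • g * D * g).trace
      = (Fintype.card m : ℂ)⁻¹
        * (D * (g * D * ((1 - (A + D))⁻¹ - (1 - (A - D))⁻¹) * g)).trace := by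
    rw [← trace_resolvent_sub_resolvent hA hDskew, map_neg, ← sub_eq_add_neg]
    simp only [resolventTrace, smul_mul, trace_smul, smul_eq_mul]
    ring
  calc _ = (Fintype.card m : ℝ)⁻¹
        * ‖(D * (g * D * ((1 - (A + D))⁻¹ - (1 - (A - D))⁻¹) * g)).trace‖ := by
        simpa using congrArg norm difference
    _ ≤ (Fintype.card m : ℝ)⁻¹ * (δ * (δ * (2 * min 1 δ))) := by
        gcongr
        refine (norm_trace_rankTwo_mul_le x a t _).trans ?_
        gcongr
        exact norm_resolvent_remainder_le hA hDskew (norm_rankTwo_le x a t)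
    _ = (Fintype.card m : ℝ)⁻¹ * (2 * (δ * (δ * min 1 δ))) := by ring
    _ ≤ (Fintype.card m : ℝ)⁻¹ * (2 * δ ^ r) := by
        gcongr
        exact mul_mul_min_one_le_rpow (by positivity) hr

end Resolvent

section Lindeberg

variable {ι : Type*} [DecidableEq ι] {X : ι → Type*}

/-- Apply `f` to the coordinates in `T` and leave the others unchanged: an intermediate stage of the
Lindeberg replacement of `z` by `fun i => f i (z i)`. -/
def mapOn (f : (i : ι) → X i → X i) (T : Finset ι) (z : (i : ι) → X i) : (i : ι) → X i :=
  T.piecewise (fun i => f i (z i)) z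

theorem mapOn_update_of_notMem (f : (i : ι) → X i → X i) {T : Finset ι} {i : ι} (hi : i ∉ T)
    (z : (i : ι) → X i) (t : X i) :
    mapOn f T (Function.update z i t) = Function.update (mapOn f T z) i t := by
  ext j
  rcases eq_or_ne j i with rfl | hj
  · simp [mapOn, hi]
  · simp [mapOn, Finset.piecewise, hj]

theorem mapOn_insert_update (f : (i : ι) → X i → X i) (T : Finset ι) {i : ι}
    (z : (i : ι) → X i) (t : X i) :
    mapOn f (insert i T) (Function.update z i t) = Function.update (mapOn f T z) i (f i t) := by
  ext j
  rcases eq_or_ne j i with rfl | hj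
  · simp [mapOn]
  · simp [mapOn, Finset.piecewise, hj]

variable [∀ i, MeasurableSpace (X i)]

theorem measurable_mapOn {f : (i : ι) → X i → X i} (hf : ∀ i, Measurable (f i)) (T : Finset ι) :
    Measurable (mapOn f T) := by
  refine measurable_pi_lambda _ fun i => ?_
  by_cases h : i ∈ T <;> simp only [mapOn, h, Finset.piecewise_eq_of_mem,
    Finset.piecewise_eq_of_notMem, not_false_eq_true] <;> fun_prop

variable [Fintype ι] (ν : (i : ι) → Measure (X i)) [∀ i, IsProbabilityMeasure (ν i)]

theorem measurePreserving_update_pi (i : ι) :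
    MeasurePreserving (fun q : ((j : ι) → X j) × X i => Function.update q.1 i q.2)
      ((Measure.pi ν).prod (ν i)) (Measure.pi ν) := by
  have hm : Measurable fun q : ((j : ι) → X j) × X i => Function.update q.1 i q.2 :=
    measurable_update'
  refine ⟨hm, (Measure.pi_eq fun s hs => ?_).symm⟩
  have preimage : (fun q : ((j : ι) → X j) × X i => Function.update q.1 i q.2) ⁻¹' Set.univ.pi s
      = Set.univ.pi (Function.update s i Set.univ) ×ˢ s i := by
    ext q
    simp only [Set.mem_preimage, Set.mem_univ_pi, Set.mem_prod]
    rw [Function.forall_update_iff q.1 fun j x => x ∈ s j,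
      Function.forall_update_iff s fun j t => q.1 j ∈ t]
    simp [and_comm]
  rw [Measure.map_apply hm (MeasurableSet.univ_pi hs), preimage, Measure.prod_prod, Measure.pi_pi,
    ← Finset.mul_prod_erase _ _ (Finset.mem_univ i),
    ← Finset.mul_prod_erase _ (fun j => ν j (s j)) (Finset.mem_univ i), mul_comm,
    Function.update_self, measure_univ, one_mul]
  congr 1
  refine Finset.prod_congr rfl fun j hj => ?_
  rw [Function.update_of_ne (Finset.ne_of_mem_erase hj)]

variable {E : Type*} [NormedAddCommGroup E] [NormedSpace ℝ E]

theorem integral_pi_eq_integral_integral_update {Φ : ((i : ι) → X i) → E}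
    (hΦ : Integrable Φ (Measure.pi ν)) (i : ι) :
    ∫ z, Φ z ∂Measure.pi ν = ∫ z, ∫ t, Φ (Function.update z i t) ∂ν i ∂Measure.pi ν := by
  have hmp := measurePreserving_update_pi ν i
  rw [← integral_prod (fun q : ((j : ι) → X j) × X i => Φ (Function.update q.1 i q.2))
      ((hmp.integrable_comp hΦ.aestronglyMeasurable).2 hΦ), ← integral_map
      hmp.measurable.aemeasurable (by rw [hmp.map_eq]; exact hΦ.aestronglyMeasurable), hmp.map_eq]

theorem norm_integral_sub_le_of_lindeberg
    {f : (i : ι) → X i → X i} (hf : ∀ i, Measurable (f i)) {Φ : ((i : ι) → X i) → E}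
    (hΦ : StronglyMeasurable Φ) {C : ℝ} (hC : ∀ z, ‖Φ z‖ ≤ C) {B : ι → ℝ}
    (hB : ∀ i z, ‖∫ t, (Φ (Function.update z i t) - Φ (Function.update z i (f i t))) ∂ν i‖ ≤ B i) :
    ‖∫ z, (Φ z - Φ fun i => f i (z i)) ∂Measure.pi ν‖ ≤ ∑ i, B i := by
  have integrable (T : Finset ι) : Integrable (fun z => Φ (mapOn f T z)) (Measure.pi ν) :=
    Integrable.of_bound (hΦ.comp_measurable (measurable_mapOn hf T)).aestronglyMeasurable C
      (ae_of_all _ fun z => hC _)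
  have swap_one (i : ι) (T : Finset ι) (hi : i ∉ T) :
      ‖∫ z, (Φ (mapOn f T z) - Φ (mapOn f (insert i T) z)) ∂Measure.pi ν‖ ≤ B i := by
    rw [integral_pi_eq_integral_integral_update ν
      (Φ := fun z => Φ (mapOn f T z) - Φ (mapOn f (insert i T) z))
      ((integrable T).sub (integrable _)) i]
    simp only [mapOn_update_of_notMem f hi, mapOn_insert_update]
    simpa using norm_integral_le_of_norm_le_const (μ := Measure.pi ν)
      (ae_of_all _ fun z => hB i (mapOn f T z))
  suffices H : ∀ T : Finset ι, ‖∫ z, (Φ z - Φ (mapOn f T z)) ∂Measure.pi ν‖ ≤ ∑ i ∈ T, B i by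
    simpa [mapOn] using H Finset.univ
  intro T
  induction T using Finset.induction_on with
  | empty => simp [mapOn]
  | insert i T hi ih =>
    have telescope : ∫ z, (Φ z - Φ (mapOn f (insert i T) z)) ∂Measure.pi ν
        = ∫ z, (Φ (mapOn f T z) - Φ (mapOn f (insert i T) z)) ∂Measure.pi ν
          + ∫ z, (Φ z - Φ (mapOn f T z)) ∂Measure.pi ν := by
      have h₀ : Integrable Φ (Measure.pi ν) := by simpa [mapOn] using integrable ∅
      rw [integral_sub h₀ (integrable _), integral_sub h₀ (integrable _),
        integral_sub (integrable _) (integrable _)]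
      abel
    rw [telescope, Finset.sum_insert hi]
    exact norm_add_le_of_le (swap_one i T hi) ih

end Lindeberg

section Moments

theorem one_add_rpow_le {w q : ℝ} (hw : -1 ≤ w) (hq : q ∈ Set.Icc 1 2) :
    (1 + w) ^ q ≤ 1 + q * w + (q - 1) * w ^ 2 := by
  have h0 : 0 ≤ 1 + w := by linarith
  calc (1 + w) ^ q = (1 + w) * (1 + w) ^ (q - 1) := by
        rw [← Real.rpow_one_add' h0 (by linarith [hq.1]), add_sub_cancel]
    _ ≤ (1 + w) * (1 + (q - 1) * w) := by
        gcongr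
        exact rpow_one_add_le_one_add_mul_self hw (by linarith [hq.1]) (by linarith [hq.2])
    _ = 1 + q * w + (q - 1) * w ^ 2 := by ring

theorem rpow_le_of_sq_eq_sq_add {a b u r : ℝ} (ha : 0 < a) (hb : 0 ≤ b) (h : b ^ 2 = a ^ 2 + u)
    (hr : r ∈ Set.Icc 2 4) :
    b ^ r ≤ a ^ r + a ^ (r - 2) * (r / 2 * u + (r / 2 - 1) * (u ^ 2 / a ^ 2)) := by
  obtain ⟨hr2, hr4⟩ := hr
  set w := u / a ^ 2 with hw
  have hb_sq : b ^ 2 = a ^ 2 * (1 + w) := by rw [h, hw]; field_simp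
  have hw1 : -1 ≤ w := by
    have : 0 ≤ 1 + w := nonneg_of_mul_nonneg_right (hb_sq ▸ sq_nonneg _) (by positivity)
    linarith
  have rpow_eq_sq_rpow {y : ℝ} (hy : 0 ≤ y) : y ^ r = (y ^ 2) ^ (r / 2) := by
    rw [← Real.rpow_natCast_mul hy]
    congr 1
    push_cast
    ring
  have rpow_split : a ^ r = a ^ (r - 2) * a ^ 2 := by
    rw [← Real.rpow_natCast, ← Real.rpow_add ha]; norm_num
  calc b ^ r = a ^ r * (1 + w) ^ (r / 2) := by
        rw [rpow_eq_sq_rpow hb, hb_sq, Real.mul_rpow (by positivity) (by linarith),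
          ← rpow_eq_sq_rpow ha.le]
    _ ≤ a ^ r * (1 + r / 2 * w + (r / 2 - 1) * w ^ 2) := by
        gcongr
        exact one_add_rpow_le hw1 ⟨by linarith, by linarith⟩
    _ = a ^ r + a ^ (r - 2) * (r / 2 * u + (r / 2 - 1) * (u ^ 2 / a ^ 2)) := by
        rw [rpow_split, hw]; field_simp; ring

variable {E : Type*} [NormedAddCommGroup E] [InnerProductSpace ℝ E]

theorem norm_add_rpow_le_of_norm_le {s x : E} (h : ‖x‖ ≤ ‖s‖) {r : ℝ} (hr : r ∈ Set.Icc 2 4) :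
    ‖s + x‖ ^ r ≤ ‖s‖ ^ r + r * (‖s‖ ^ (r - 2) * inner ℝ s x) + 20 * (‖s‖ ^ (r - 2) * ‖x‖ ^ 2) := by
  rcases (norm_nonneg s).eq_or_lt with hs | hs
  · obtain rfl : s = 0 := norm_eq_zero.1 hs.symm
    obtain rfl : x = 0 := norm_le_zero_iff.1 (by simpa using h)
    simp [Real.zero_rpow (by linarith [hr.1] : r ≠ 0)]
  set u := 2 * inner ℝ s x + ‖x‖ ^ 2 with hu
  have hu_sq : u ^ 2 / ‖s‖ ^ 2 ≤ 9 * ‖x‖ ^ 2 := by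
    have hu_abs : |u| ≤ 3 * (‖s‖ * ‖x‖) := by
      have hsx := abs_le.1 (abs_real_inner_le_norm s x)
      rw [abs_le]
      constructor <;> nlinarith [norm_nonneg x]
    calc u ^ 2 / ‖s‖ ^ 2 = |u| ^ 2 / ‖s‖ ^ 2 := by rw [sq_abs]
      _ ≤ (3 * (‖s‖ * ‖x‖)) ^ 2 / ‖s‖ ^ 2 := by gcongr
      _ = 9 * ‖x‖ ^ 2 := by field_simp; ring
  have coeff : r / 2 * u + (r / 2 - 1) * (u ^ 2 / ‖s‖ ^ 2) ≤ r * inner ℝ s x + 20 * ‖x‖ ^ 2 := by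
    obtain ⟨hr2, hr4⟩ := hr
    nlinarith [mul_le_mul_of_nonneg_left hu_sq (by linarith : 0 ≤ r / 2 - 1), sq_nonneg ‖x‖]
  calc ‖s + x‖ ^ r
      ≤ ‖s‖ ^ r + ‖s‖ ^ (r - 2) * (r / 2 * u + (r / 2 - 1) * (u ^ 2 / ‖s‖ ^ 2)) :=
        rpow_le_of_sq_eq_sq_add hs (norm_nonneg _) (by rw [norm_add_sq_real, hu, add_assoc]) hr
    _ ≤ ‖s‖ ^ r + ‖s‖ ^ (r - 2) * (r * inner ℝ s x + 20 * ‖x‖ ^ 2) :=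
        add_le_add_right (mul_le_mul_of_nonneg_left coeff (by positivity)) _
    _ = _ := by ring

theorem norm_add_rpow_le (s x : E) {r : ℝ} (hr : r ∈ Set.Icc 2 4) :
    ‖s + x‖ ^ r ≤ ‖s‖ ^ r + r * (‖s‖ ^ (r - 2) * inner ℝ s x)
      + 20 * (‖s‖ ^ (r - 2) * ‖x‖ ^ 2 + ‖x‖ ^ r) := by
  rcases le_or_gt ‖x‖ ‖s‖ with h | h
  · have := norm_add_rpow_le_of_norm_le h hr
    have : 0 ≤ ‖x‖ ^ r := by positivity
    linarith
  obtain ⟨hr2, hr4⟩ := hr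
  have hx : 0 < ‖x‖ := (norm_nonneg s).trans_lt h
  have cross : -(‖x‖ ^ r) ≤ ‖s‖ ^ (r - 2) * inner ℝ s x := by
    calc -(‖x‖ ^ r) = -(‖x‖ ^ (r - 2) * (‖x‖ * ‖x‖)) := by
          rw [← pow_two, ← Real.rpow_natCast, ← Real.rpow_add hx]; norm_num
      _ ≤ -(‖s‖ ^ (r - 2) * (‖s‖ * ‖x‖)) := by gcongr
      _ ≤ ‖s‖ ^ (r - 2) * inner ℝ s x := by
          rw [neg_le_iff_add_nonneg, ← mul_add]
          have := (abs_le.1 (abs_real_inner_le_norm s x)).1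
          have : 0 ≤ inner ℝ s x + ‖s‖ * ‖x‖ := by linarith
          positivity
  have total : ‖s + x‖ ^ r ≤ 16 * ‖x‖ ^ r := by
    calc ‖s + x‖ ^ r ≤ (2 * ‖x‖) ^ r := by
          gcongr
          exact (norm_add_le s x).trans (by linarith)
      _ = 2 ^ r * ‖x‖ ^ r := Real.mul_rpow zero_le_two hx.le
      _ ≤ 2 ^ (4 : ℝ) * ‖x‖ ^ r := by gcongr; norm_num
      _ = 16 * ‖x‖ ^ r := by norm_num
  have : 0 ≤ ‖s‖ ^ r := by positivity
  have : 0 ≤ ‖s‖ ^ (r - 2) * ‖x‖ ^ 2 := by positivity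
  have : 0 ≤ ‖x‖ ^ r := by positivity
  nlinarith

theorem rpow_add_rpow_sub_one_mul_le {x y a : ℝ} (hx : 0 ≤ x) (hy : 0 ≤ y) (ha : 1 ≤ a) :
    x ^ a + x ^ (a - 1) * y ≤ (x + y) ^ a := by
  have rpow_split {t : ℝ} (ht : 0 ≤ t) : t ^ a = t ^ (a - 1) * t := by
    rw [← Real.rpow_add_one' ht (by linarith), sub_add_cancel]
  rw [rpow_split hx, rpow_split (add_nonneg hx hy), ← mul_add]
  gcongr
  linarith

theorem sum_rpow_le_rpow_sum {ι : Type*} (s : Finset ι) {f : ι → ℝ} (hf : ∀ i, 0 ≤ f i) {a : ℝ}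
    (ha : 1 ≤ a) : ∑ i ∈ s, f i ^ a ≤ (∑ i ∈ s, f i) ^ a := by
  classical
  induction s using Finset.induction_on with
  | empty => simp [Real.zero_rpow (by linarith : a ≠ 0)]
  | insert i s his ih =>
    rw [Finset.sum_insert his, Finset.sum_insert his]
    exact (add_le_add_right ih _).trans
      (Real.add_rpow_le_rpow_add (hf i) (Finset.sum_nonneg fun j _ => hf j) ha)

variable {Ω : Type*} [MeasurableSpace Ω] {μ : Measure Ω} [IsProbabilityMeasure μ] {r : ℝ}

omit [InnerProductSpace ℝ E] in
theorem integrable_norm_rpow_of_memLp {X : Ω → E} {a : ℝ} (hX : MemLp X (ENNReal.ofReal r) μ)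
    (ha : a ∈ Set.Icc 0 r) : Integrable (fun ω => ‖X ω‖ ^ a) μ := by
  simpa only [ENNReal.toReal_ofReal ha.1] using
    (hX.mono_exponent (ENNReal.ofReal_le_ofReal ha.2)).integrable_norm_rpow'

omit [InnerProductSpace ℝ E] in
theorem integral_norm_rpow_le_rpow {X : Ω → E} {a : ℝ} (hX : MemLp X (ENNReal.ofReal r) μ)
    (hr : 0 < r) (ha : a ∈ Set.Icc 0 r) :
    ∫ ω, ‖X ω‖ ^ a ∂μ ≤ (∫ ω, ‖X ω‖ ^ r ∂μ) ^ (a / r) := by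
  have har : a / r ∈ Set.Icc 0 1 := ⟨div_nonneg ha.1 hr.le, div_le_one_of_le₀ ha.2 hr.le⟩
  have hpow ω : (‖X ω‖ ^ r) ^ (a / r) = ‖X ω‖ ^ a := by
    rw [← Real.rpow_mul (norm_nonneg _), mul_div_cancel₀ _ hr.ne']
  simp only [← hpow]
  refine (Real.concaveOn_rpow har.1 har.2).le_map_integral
    (Real.continuous_rpow_const har.1).continuousOn isClosed_Ici (ae_of_all _ fun ω => ?_)
    (integrable_norm_rpow_of_memLp hX (Set.right_mem_Icc.2 hr.le)) ?_
  · exact Real.rpow_nonneg (norm_nonneg _) r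
  · exact (integrable_norm_rpow_of_memLp hX ha).congr (ae_of_all _ fun ω => (hpow ω).symm)

omit [InnerProductSpace ℝ E] in
theorem integrable_norm_sq_of_memLp {X : Ω → E} (hX : MemLp X (ENNReal.ofReal r) μ) (hr : 2 ≤ r) :
    Integrable (fun ω => ‖X ω‖ ^ 2) μ := by
  simpa using integrable_norm_rpow_of_memLp hX ⟨zero_le_two, hr⟩

omit [InnerProductSpace ℝ E] in
theorem integrable_norm_rpow_smul [NormedSpace ℝ E] {X : Ω → E}
    (hX : MemLp X (ENNReal.ofReal r) μ) (hr : 2 ≤ r) :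
    Integrable (fun ω => ‖X ω‖ ^ (r - 2) • X ω) μ := by
  have smul_meas : AEStronglyMeasurable (fun ω => ‖X ω‖ ^ (r - 2) • X ω) μ :=
    ((Real.continuous_rpow_const (by linarith)).comp_aestronglyMeasurable
      hX.aestronglyMeasurable.norm).smul hX.aestronglyMeasurable
  refine (integrable_norm_rpow_of_memLp hX ⟨by linarith, by linarith⟩ : Integrable
    (fun ω => ‖X ω‖ ^ (r - 1)) μ).mono' smul_meas (ae_of_all _ fun ω => le_of_eq ?_)
  rw [norm_smul, Real.norm_of_nonneg (by positivity),
    ← Real.rpow_add_one' (norm_nonneg _) (by linarith)]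
  ring_nf

variable [MeasurableSpace E] [BorelSpace E]

omit [IsProbabilityMeasure μ] in
theorem integrable_inner_of_indepFun {S X : Ω → E} (hSX : IndepFun S X μ)
    (hS : Integrable S μ) (hX : Integrable X μ) :
    Integrable (fun ω => inner ℝ (S ω) (X ω)) μ :=
  hSX.integrable_bilin hS hX (innerSL ℝ)

variable [CompleteSpace E]

omit [IsProbabilityMeasure μ] in
theorem integral_inner_of_indepFun {S X : Ω → E} (hSX : IndepFun S X μ)
    (hS : Integrable S μ) (hX : Integrable X μ) :
    ∫ ω, inner ℝ (S ω) (X ω) ∂μ = inner ℝ (∫ ω, S ω ∂μ) (∫ ω, X ω ∂μ) :=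
  hSX.integral_bilin hS hX (innerSL ℝ)

theorem integral_norm_add_sq {S X : Ω → E} (hSX : IndepFun S X μ)
    (hS : MemLp S 2 μ) (hX : MemLp X 2 μ) (hX0 : ∫ ω, X ω ∂μ = 0) :
    ∫ ω, ‖S ω + X ω‖ ^ 2 ∂μ = ∫ ω, ‖S ω‖ ^ 2 ∂μ + ∫ ω, ‖X ω‖ ^ 2 ∂μ := by
  have hS1 := hS.integrable one_le_two
  have hX1 := hX.integrable one_le_two
  have inner_integrable := (integrable_inner_of_indepFun hSX hS1 hX1).const_mul 2
  have hS2 := hS.integrable_norm_pow two_ne_zero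
  have hX2 := hX.integrable_norm_pow two_ne_zero
  simp only [norm_add_sq_real]
  rw [integral_add (hS2.fun_add inner_integrable) hX2, integral_add hS2 inner_integrable,
    integral_const_mul, integral_inner_of_indepFun hSX hS1 hX1, hX0, inner_zero_right, mul_zero,
    add_zero]

theorem integral_norm_add_rpow_le [SecondCountableTopology E] {S X : Ω → E} (hSX : IndepFun S X μ)
    (hS : MemLp S (ENNReal.ofReal r) μ) (hX : MemLp X (ENNReal.ofReal r) μ)
    (hX0 : ∫ ω, X ω ∂μ = 0) (hr : r ∈ Set.Icc 2 4) :
    ∫ ω, ‖S ω + X ω‖ ^ r ∂μ ≤ ∫ ω, ‖S ω‖ ^ r ∂μ +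
      20 * ((∫ ω, ‖S ω‖ ^ 2 ∂μ) ^ (r / 2 - 1) * ∫ ω, ‖X ω‖ ^ 2 ∂μ + ∫ ω, ‖X ω‖ ^ r ∂μ) := by
  have hr0 : 0 ≤ r := by linarith [hr.1]
  have hX1 : Integrable X μ := hX.integrable (by simpa using by linarith [hr.1])
  have weight_integrable := integrable_norm_rpow_smul hS hr.1
  have weight_indep : IndepFun (fun ω => ‖S ω‖ ^ (r - 2) • S ω) X μ :=
    hSX.comp (φ := fun s => ‖s‖ ^ (r - 2) • s) (by fun_prop) measurable_id
  have cross_integrable := integrable_inner_of_indepFun weight_indep weight_integrable hX1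
  have cross := integral_inner_of_indepFun weight_indep weight_integrable hX1
  simp only [real_inner_smul_left] at cross_integrable cross
  rw [hX0, inner_zero_right] at cross
  have hS2 := integrable_norm_rpow_of_memLp hS (a := r - 2) ⟨by linarith [hr.1], by linarith⟩
  have hSr := integrable_norm_rpow_of_memLp hS (Set.right_mem_Icc.2 hr0)
  have hXr := integrable_norm_rpow_of_memLp hX (Set.right_mem_Icc.2 hr0)
  have hX2 := integrable_norm_sq_of_memLp hX hr.1
  have prod_indep : IndepFun (fun ω => ‖S ω‖ ^ (r - 2)) (fun ω => ‖X ω‖ ^ 2) μ :=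
    hSX.comp (φ := fun s => ‖s‖ ^ (r - 2)) (ψ := fun x => ‖x‖ ^ 2) (by fun_prop) (by fun_prop)
  have prod_integrable : Integrable (fun ω => ‖S ω‖ ^ (r - 2) * ‖X ω‖ ^ 2) μ :=
    prod_indep.integrable_mul hS2 hX2
  have hSX_sum : Integrable (fun ω => ‖S ω + X ω‖ ^ r) μ :=
    integrable_norm_rpow_of_memLp (hS.add hX) (Set.right_mem_Icc.2 hr0)
  have jensen : ∫ ω, ‖S ω‖ ^ (r - 2) ∂μ ≤ (∫ ω, ‖S ω‖ ^ 2 ∂μ) ^ (r / 2 - 1) := by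
    have hSL2 : MemLp S (ENNReal.ofReal 2) μ := hS.mono_exponent (ENNReal.ofReal_le_ofReal hr.1)
    have h := integral_norm_rpow_le_rpow hSL2 two_pos (a := r - 2)
      ⟨by linarith [hr.1], by linarith [hr.2]⟩
    simpa only [Real.rpow_two, sub_div, div_self (two_ne_zero' ℝ)] using h
  have left_integrable := hSr.fun_add (cross_integrable.const_mul r)
  have right_integrable := (prod_integrable.fun_add hXr).const_mul 20
  calc ∫ ω, ‖S ω + X ω‖ ^ r ∂μ
      ≤ ∫ ω, (‖S ω‖ ^ r + r * (‖S ω‖ ^ (r - 2) * inner ℝ (S ω) (X ω))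
          + 20 * (‖S ω‖ ^ (r - 2) * ‖X ω‖ ^ 2 + ‖X ω‖ ^ r)) ∂μ :=
        integral_mono hSX_sum (left_integrable.fun_add right_integrable)
          fun ω => norm_add_rpow_le _ _ hr
    _ = ∫ ω, ‖S ω‖ ^ r ∂μ + 20 * ((∫ ω, ‖S ω‖ ^ (r - 2) ∂μ) * ∫ ω, ‖X ω‖ ^ 2 ∂μ
          + ∫ ω, ‖X ω‖ ^ r ∂μ) := by
        rw [integral_add left_integrable right_integrable,
          integral_add hSr (cross_integrable.const_mul r), integral_const_mul, integral_const_mul,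
          integral_add prod_integrable hXr, cross, mul_zero, add_zero,
          prod_indep.integral_fun_mul_eq_mul_integral hS2.aestronglyMeasurable
            hX2.aestronglyMeasurable]
    _ ≤ _ := by gcongr

variable [SecondCountableTopology E] {ι : Type*} {X : ι → Ω → E}

theorem integral_norm_sum_sq (hind : iIndepFun X μ) (hX : ∀ i, MemLp (X i) 2 μ)
    (hX0 : ∀ i, ∫ ω, X i ω ∂μ = 0) (s : Finset ι) :
    ∫ ω, ‖∑ i ∈ s, X i ω‖ ^ 2 ∂μ = ∑ i ∈ s, ∫ ω, ‖X i ω‖ ^ 2 ∂μ := by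
  classical
  induction s using Finset.induction_on with
  | empty => simp
  | insert i s his ih =>
    have hsum : IndepFun (fun ω => ∑ j ∈ s, X j ω) (X i) μ := by
      simpa only [Finset.sum_fn] using hind.indepFun_finsetSum_of_notMem₀
        (fun j => (hX j).aestronglyMeasurable.aemeasurable) his
    simp only [Finset.sum_insert his, ← ih, add_comm (X i _), add_comm (∫ ω, ‖X i ω‖ ^ 2 ∂μ)]
    exact integral_norm_add_sq hsum (memLp_finsetSum s fun j _ => hX j) (hX i) (hX0 i)

theorem integral_norm_sum_rpow_le (hind : iIndepFun X μ)
    (hX : ∀ i, MemLp (X i) (ENNReal.ofReal r) μ) (hX0 : ∀ i, ∫ ω, X i ω ∂μ = 0)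
    (hr : r ∈ Set.Icc 2 4) (s : Finset ι) :
    ∫ ω, ‖∑ i ∈ s, X i ω‖ ^ r ∂μ ≤
      20 * ((∑ i ∈ s, ∫ ω, ‖X i ω‖ ^ 2 ∂μ) ^ (r / 2) + ∑ i ∈ s, ∫ ω, ‖X i ω‖ ^ r ∂μ) := by
  classical
  have hr0 : r / 2 ≠ 0 := by linarith [hr.1]
  have hX2 i : MemLp (X i) 2 μ := (hX i).mono_exponent (by simpa using hr.1)
  induction s using Finset.induction_on with
  | empty => simp [Real.zero_rpow (by linarith [hr.1] : r ≠ 0), Real.zero_rpow hr0]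
  | insert i s his ih =>
    have hsum : IndepFun (fun ω => ∑ j ∈ s, X j ω) (X i) μ := by
      simpa only [Finset.sum_fn] using hind.indepFun_finsetSum_of_notMem₀
        (fun j => (hX j).aestronglyMeasurable.aemeasurable) his
    have hstep := integral_norm_add_rpow_le hsum (memLp_finsetSum s fun j _ => hX j) (hX i)
      (hX0 i) hr
    rw [integral_norm_sum_sq hind hX2 hX0] at hstep
    simp only [Finset.sum_insert his, add_comm (X i _)]
    set V := ∑ j ∈ s, ∫ ω, ‖X j ω‖ ^ 2 ∂μ
    set v := ∫ ω, ‖X i ω‖ ^ 2 ∂μ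
    have hsuper : V ^ (r / 2) + V ^ (r / 2 - 1) * v ≤ (V + v) ^ (r / 2) :=
      rpow_add_rpow_sub_one_mul_le (Finset.sum_nonneg fun j _ => integral_nonneg fun ω =>
        sq_nonneg _) (integral_nonneg fun ω => sq_nonneg _) (by linarith [hr.1])
    rw [add_comm v V]
    linarith

theorem integral_norm_sum_smul_rpow_le [NormedSpace ℂ E] [Fintype ι] {z : ι → Ω → ℂ} {M : ℝ}
    (hind : iIndepFun z μ) (hz : ∀ i, MemLp (z i) (ENNReal.ofReal r) μ)
    (hz0 : ∀ i, ∫ ω, z i ω ∂μ = 0) (hM0 : 0 ≤ M) (hM : ∀ i, ∫ ω, ‖z i ω‖ ^ r ∂μ ≤ M)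
    (hr : r ∈ Set.Icc 2 4) (b : ι → E) :
    ∫ ω, ‖∑ i, z i ω • b i‖ ^ r ∂μ ≤ 40 * M * (∑ i, ‖b i‖ ^ 2) ^ (r / 2) := by
  have hr0 : 0 < r := by linarith [hr.1]
  have hrosenthal := integral_norm_sum_rpow_le (X := fun i ω => z i ω • b i)
    (hind.comp (fun i t => t • b i) fun i => by fun_prop)
    (fun i => (ContinuousLinearMap.toSpanSingleton ℂ (b i)).comp_memLp' (hz i))
    (fun i => by rw [integral_smul_const, hz0, zero_smul]) hr Finset.univ
  simp only [norm_smul, mul_pow, Real.mul_rpow (norm_nonneg _) (norm_nonneg _),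
    integral_mul_const] at hrosenthal ⊢
  have second_moment i : ∫ ω, ‖z i ω‖ ^ 2 ∂μ ≤ M ^ (2 / r) := by
    calc ∫ ω, ‖z i ω‖ ^ 2 ∂μ ≤ (∫ ω, ‖z i ω‖ ^ r ∂μ) ^ (2 / r) := by
          simpa using integral_norm_rpow_le_rpow (hz i) hr0 (a := 2) ⟨zero_le_two, hr.1⟩
      _ ≤ M ^ (2 / r) := by
          gcongr
          exact hM i
  have gaussian_part : (∑ i, (∫ ω, ‖z i ω‖ ^ 2 ∂μ) * ‖b i‖ ^ 2) ^ (r / 2)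
      ≤ M * (∑ i, ‖b i‖ ^ 2) ^ (r / 2) := by
    calc (∑ i, (∫ ω, ‖z i ω‖ ^ 2 ∂μ) * ‖b i‖ ^ 2) ^ (r / 2)
        ≤ (M ^ (2 / r) * ∑ i, ‖b i‖ ^ 2) ^ (r / 2) := by
          rw [Finset.mul_sum]
          gcongr with i
          exact second_moment i
      _ = M * (∑ i, ‖b i‖ ^ 2) ^ (r / 2) := by
          rw [Real.mul_rpow (by positivity) (by positivity), ← Real.rpow_mul hM0,
            div_mul_div_cancel₀ hr0.ne', div_self two_ne_zero, Real.rpow_one]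
  have jump_part : ∑ i, (∫ ω, ‖z i ω‖ ^ r ∂μ) * ‖b i‖ ^ r ≤ M * (∑ i, ‖b i‖ ^ 2) ^ (r / 2) := by
    calc ∑ i, (∫ ω, ‖z i ω‖ ^ r ∂μ) * ‖b i‖ ^ r ≤ M * ∑ i, ‖b i‖ ^ r := by
          rw [Finset.mul_sum]
          gcongr with i
          exact hM i
      _ ≤ M * (∑ i, ‖b i‖ ^ 2) ^ (r / 2) := by
          gcongr
          simpa only [← Real.rpow_natCast_mul (norm_nonneg _), Nat.cast_ofNat,
            mul_div_cancel₀ r (two_ne_zero' ℝ)] using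
            sum_rpow_le_rpow_sum Finset.univ (fun i => sq_nonneg ‖b i‖)
              (by linarith [hr.1] : 1 ≤ r / 2)
  linarith

end Moments

section Comparison

open Matrix

variable {α l m n : Type*} [MeasurableSpace α]

theorem measurable_mul_apply [Fintype m] {X : α → Matrix l m ℂ} {Y : α → Matrix m n ℂ}
    (hX : ∀ i j, Measurable fun a => X a i j) (hY : ∀ i j, Measurable fun a => Y a i j)
    (i : l) (j : n) : Measurable fun a => (X a * Y a) i j := by
  simp only [mul_apply]
  fun_prop

theorem measurable_resolventTrace [Fintype m] [DecidableEq m] {A : α → Matrix m m ℂ}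
    (hA : ∀ i j, Measurable fun a => A a i j) : Measurable fun a => resolventTrace (A a) := by
  have hsub : Measurable fun a => (fun i j => (1 - A a) i j : m → m → ℂ) :=
    measurable_pi_lambda _ fun i => measurable_pi_lambda _ fun j => (hA i j).const_sub _
  have hdet : Continuous fun M : m → m → ℂ => (of M).det := Continuous.matrix_det continuous_id
  have hadj : Continuous fun M : m → m → ℂ => (of M).adjugate.trace :=
    Continuous.matrix_trace (Continuous.matrix_adjugate continuous_id)
  simp only [resolventTrace, inv_def, Ring.inverse_eq_inv', trace_smul]
  exact ((hdet.measurable.comp hsub).inv.smul (hadj.measurable.comp hsub)).const_mul _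

/-- The skew-Hermitian matrix `X Y* - Y X*` attached to a pair of rectangular matrices. -/
def skewProduct [Fintype n] (X Y : Matrix m n ℂ) : Matrix m m ℂ := X * Yᴴ - Y * Xᴴ

/-- The `k`-th column of a matrix as a vector of the Hermitian space, so that `‖colVec B k‖` is its
Euclidean norm. -/
def colVec (B : Matrix l m ℂ) (k : m) : EuclideanSpace ℂ l := WithLp.toLp 2 (B.col k)

theorem colVec_smul (s : ℝ) (B : Matrix l m ℂ) (k : m) : colVec (s • B) k = s • colVec B k := rfl

theorem colVec_mul [Fintype m] (B : Matrix l m ℂ) (X : Matrix m n ℂ) (j : n) :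
    colVec (B * X) j = ∑ k, X k j • colVec B k := by
  ext i
  simp [colVec, mul_apply, mul_comm]

section

variable [Fintype n]

theorem skewProduct_mem_skewAdjoint (X Y : Matrix m n ℂ) :
    skewProduct X Y ∈ skewAdjoint (Matrix m m ℂ) := by
  simp [skewAdjoint.mem_iff, skewProduct, star_eq_conjTranspose]

theorem skewProduct_add_right (X Y Y' : Matrix m n ℂ) :
    skewProduct X (Y + Y') = skewProduct X Y + skewProduct X Y' := by
  simp only [skewProduct, conjTranspose_add, Matrix.mul_add, Matrix.add_mul]
  abel

theorem skewProduct_neg_right (X Y : Matrix m n ℂ) : skewProduct X (-Y) = -skewProduct X Y := by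
  simp [skewProduct, sub_eq_add_neg, add_comm]

theorem smul_skewProduct (s : ℝ) (X Y : Matrix m n ℂ) :
    s • skewProduct X Y = skewProduct (s • X) Y := by
  simp [skewProduct, smul_sub]

theorem measurable_skewProduct_apply {X Y : α → Matrix m n ℂ}
    (hX : ∀ i j, Measurable fun a => X a i j) (hY : ∀ i j, Measurable fun a => Y a i j)
    (i j : m) : Measurable fun a => skewProduct (X a) (Y a) i j :=
  (measurable_mul_apply hX (fun k l => continuous_star.measurable.comp (hY l k)) i j).sub
    (measurable_mul_apply hY (fun k l => continuous_star.measurable.comp (hX l k)) i j)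

theorem skewProduct_mul_single [Fintype m] [DecidableEq m] [DecidableEq n] (X : Matrix l n ℂ)
    (B : Matrix l m ℂ) (i : m) (j : n) (t : ℂ) :
    skewProduct X (B * single i j t) = rankTwo (colVec X j) (colVec B i) t := by
  have mul_single : B * single i j t = of fun k q => if q = j then B k i * t else 0 := by
    ext k q
    rcases eq_or_ne q j with rfl | h
    · simp
    · simp [mul_single_apply_of_ne _ _ _ _ _ h, h]
  ext k q
  simp [skewProduct, mul_single, rankTwo, colVec, mul_apply, vecMulVec_apply,
    apply_ite (starRingEnd ℂ)]
  ring

end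

theorem of_update_eq_add_single {R : Type*} [AddZeroClass R] [DecidableEq m] [DecidableEq n]
    (y : m × n → R) (i : m × n) (t : R) :
    (of fun k l => Function.update y i t (k, l))
      = (of fun k l => Function.update y i 0 (k, l)) + single i.1 i.2 t := by
  ext k l
  rcases eq_or_ne (k, l) i with rfl | h
  · simp
  · have : ¬(i.1 = k ∧ i.2 = l) := fun hi => h (Prod.ext hi.1.symm hi.2.symm)
    simp [h, this]

section

variable [Fintype m] [DecidableEq m] {r M : ℝ}

theorem measurable_resolventTrace_add_rankTwo (A : Matrix m m ℂ) (x a : EuclideanSpace ℂ m) :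
    Measurable fun t : ℂ => resolventTrace (A + rankTwo x a t) := by
  refine measurable_resolventTrace fun i j => Continuous.measurable ?_
  simp only [rankTwo, LinearMap.coe_mk, AddHom.coe_mk, Matrix.add_apply, Matrix.sub_apply,
    Matrix.smul_apply]
  fun_prop

theorem norm_integral_resolventTrace_rankTwo_sub_neg_le {ν : Measure ℂ} [IsProbabilityMeasure ν]
    (hr : r ∈ Set.Icc 2 3) (hν : MemLp id (ENNReal.ofReal r) ν) (hν0 : ∫ t, t ∂ν = 0)
    (hM : ∫ t, ‖t‖ ^ r ∂ν ≤ M) {A : Matrix m m ℂ} (hA : A ∈ skewAdjoint (Matrix m m ℂ))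
    (x a : EuclideanSpace ℂ m) :
    ‖∫ t, (resolventTrace (A + rankTwo x a t) - resolventTrace (A + rankTwo x a (-t))) ∂ν‖
      ≤ (Fintype.card m : ℝ)⁻¹ * (2 ^ (r + 1) * M * ‖a‖ ^ r * ‖x‖ ^ r) := by
  obtain ⟨ℓ, hℓ⟩ := exists_linear_approx_resolventTrace hA x a hr
  set ℓc := ℓ.toContinuousLinearMap
  set f : ℂ → ℂ := fun t =>
    resolventTrace (A + rankTwo x a t) - resolventTrace (A + rankTwo x a (-t))
  have hr0 : 0 < r := by linarith [hr.1]
  have id_integrable : Integrable (fun t : ℂ => t) ν := hν.integrable (by simp; linarith [hr.1])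
  have pow_integrable : Integrable (fun t : ℂ => ‖t‖ ^ r) ν :=
    integrable_norm_rpow_of_memLp hν (Set.right_mem_Icc.2 hr0.le)
  have f_integrable : Integrable f ν := by
    have hτ := measurable_resolventTrace_add_rankTwo A x a
    refine .of_bound (hτ.sub (hτ.comp measurable_neg)).aestronglyMeasurable 2
      (ae_of_all _ fun t => ?_)
    have skew u := add_mem hA (rankTwo_mem_skewAdjoint x a u)
    exact (norm_sub_le_of_le (norm_resolventTrace_le_one (skew t))
      (norm_resolventTrace_le_one (skew (-t)))).trans_eq one_add_one_eq_two
  have linear_part : ∫ t, ℓc t ∂ν = 0 := by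
    rw [ℓc.integral_comp_comm id_integrable, hν0, map_zero]
  calc ‖∫ t, f t ∂ν‖ = ‖∫ t, (f t - ℓc t) ∂ν‖ := by
        rw [integral_sub f_integrable (ℓc.integrable_comp id_integrable), linear_part, sub_zero]
    _ ≤ ∫ t, (Fintype.card m : ℝ)⁻¹ * (2 ^ (r + 1) * ‖a‖ ^ r * ‖x‖ ^ r) * ‖t‖ ^ r ∂ν := by
        refine norm_integral_le_of_norm_le (pow_integrable.const_mul _) (ae_of_all _ fun t =>
          (hℓ t).trans_eq ?_)
        rw [Real.mul_rpow (by positivity) (by positivity),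
          Real.mul_rpow (by positivity) (by positivity),
          Real.mul_rpow (by positivity) (by positivity), Real.rpow_add_one two_ne_zero]
        ring
    _ = (Fintype.card m : ℝ)⁻¹ * (2 ^ (r + 1) * (∫ t, ‖t‖ ^ r ∂ν) * ‖a‖ ^ r * ‖x‖ ^ r) := by
        rw [integral_const_mul]; ring
    _ ≤ _ := by gcongr

/-- The difference of the normalized resolvent traces of `A` and `-A`, which measures how far the
spectrum of `A` is from being symmetric about the origin. -/
noncomputable def resolventAsymmetry (A : Matrix m m ℂ) : ℂ :=
  resolventTrace A - resolventTrace (-A)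

theorem measurable_resolventAsymmetry {A : α → Matrix m m ℂ}
    (hA : ∀ i j, Measurable fun a => A a i j) : Measurable fun a => resolventAsymmetry (A a) :=
  (measurable_resolventTrace hA).sub (measurable_resolventTrace fun i j => (hA i j).neg)

theorem norm_resolventAsymmetry_le_two {A : Matrix m m ℂ} (hA : A ∈ skewAdjoint (Matrix m m ℂ)) :
    ‖resolventAsymmetry A‖ ≤ 2 :=
  (norm_sub_le_of_le (norm_resolventTrace_le_one hA)
    (norm_resolventTrace_le_one (neg_mem hA))).trans_eq one_add_one_eq_two

variable [Fintype n]

theorem norm_integral_pi_resolventAsymmetry_le (hr : r ∈ Set.Icc 2 3)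
    {ν : m × n → Measure ℂ} [∀ i, IsProbabilityMeasure (ν i)]
    (hν : ∀ i, MemLp id (ENNReal.ofReal r) (ν i)) (hν0 : ∀ i, ∫ t, t ∂ν i = 0)
    (hM : ∀ i, ∫ t, ‖t‖ ^ r ∂ν i ≤ M) (X : Matrix m n ℂ) (B : Matrix m m ℂ) :
    ‖∫ y, resolventAsymmetry (skewProduct X (B * of fun i j => y (i, j))) ∂Measure.pi ν‖
      ≤ (Fintype.card m : ℝ)⁻¹ *
        (2 ^ (r + 1) * M * (∑ i, ‖colVec B i‖ ^ r) * ∑ j, ‖colVec X j‖ ^ r) := by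
  classical
  set Φ : (m × n → ℂ) → ℂ := fun y => resolventTrace (skewProduct X (B * of fun i j => y (i, j)))
  have hΦ : Measurable Φ := measurable_resolventTrace <| measurable_skewProduct_apply
    (fun _ _ => measurable_const) (measurable_mul_apply (fun _ _ => measurable_const)
      fun i j => measurable_pi_apply (i, j))
  have hΦ1 y : ‖Φ y‖ ≤ 1 := norm_resolventTrace_le_one (skewProduct_mem_skewAdjoint _ _)
  have hΦ_neg (y : m × n → ℂ) :
      Φ (fun i => -y i) = resolventTrace (-skewProduct X (B * of fun i j => y (i, j))) := by
    rw [← skewProduct_neg_right, ← Matrix.mul_neg]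
    rfl
  have hΦ_update y i t : Φ (Function.update y i t) = resolventTrace
      (skewProduct X (B * of fun k l => Function.update y i 0 (k, l))
        + rankTwo (colVec X i.2) (colVec B i.1) t) := by
    rw [← skewProduct_mul_single, ← skewProduct_add_right, ← Matrix.mul_add,
      ← of_update_eq_add_single]
  have hlindeberg := norm_integral_sub_le_of_lindeberg ν (f := fun _ t => -t)
    (fun _ => measurable_neg) hΦ.stronglyMeasurable hΦ1
    (fun i y => by
      simp only [hΦ_update]
      exact norm_integral_resolventTrace_rankTwo_sub_neg_le hr (hν i) (hν0 i) (hM i)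
        (skewProduct_mem_skewAdjoint _ _) _ _)
  simp only [hΦ_neg] at hlindeberg
  refine hlindeberg.trans_eq ?_
  rw [← Finset.mul_sum, Fintype.sum_prod_type, mul_assoc (2 ^ (r + 1) * M), Finset.sum_mul_sum]
  simp only [Finset.mul_sum, mul_assoc]

variable {Ω : Type*} [MeasurableSpace Ω] {μ : Measure Ω}

theorem norm_integral_resolventAsymmetry_le_of_left (hr : r ∈ Set.Icc 2 3)
    {Z : m × n → Ω → ℂ} (hind : iIndepFun Z μ) (hZ : ∀ i, MemLp (Z i) (ENNReal.ofReal r) μ)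
    (hZ0 : ∀ i, ∫ ω, Z i ω ∂μ = 0) (hM : ∀ i, ∫ ω, ‖Z i ω‖ ^ r ∂μ ≤ M)
    (X : Matrix m n ℂ) (B : Matrix m m ℂ) :
    ‖∫ ω, resolventAsymmetry (skewProduct X (B * of fun i j => Z (i, j) ω)) ∂μ‖
      ≤ (Fintype.card m : ℝ)⁻¹ *
        (2 ^ (r + 1) * M * (∑ i, ‖colVec B i‖ ^ r) * ∑ j, ‖colVec X j‖ ^ r) := by
  classical
  have : IsProbabilityMeasure μ := hind.isProbabilityMeasure
  have Z_ae i : AEMeasurable (Z i) μ := (hZ i).aemeasurable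
  have law := hind.map_fun_eq_pi_map Z_ae
  have law_prob (i : m × n) : IsProbabilityMeasure (μ.map (Z i)) :=
    Measure.isProbabilityMeasure_map (Z_ae i)
  have norm_pow_measurable : Measurable fun t : ℂ => ‖t‖ ^ r := by fun_prop
  have h := norm_integral_pi_resolventAsymmetry_le hr (ν := fun i => μ.map (Z i))
    (fun i => (memLp_map_measure_iff aestronglyMeasurable_id (Z_ae i)).2 (hZ i))
    (fun i => (integral_map (Z_ae i) aestronglyMeasurable_id).trans (hZ0 i))
    (fun i => (integral_map (Z_ae i) norm_pow_measurable.aestronglyMeasurable).trans_le (hM i)) X B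
  have asymmetry_measurable : Measurable fun y : m × n → ℂ =>
      resolventAsymmetry (skewProduct X (B * of fun i j => y (i, j))) :=
    measurable_resolventAsymmetry <| measurable_skewProduct_apply (fun _ _ => measurable_const)
      (measurable_mul_apply (fun _ _ => measurable_const) fun i j => measurable_pi_apply (i, j))
  rwa [← law, integral_map (aemeasurable_pi_lambda _ Z_ae)
    asymmetry_measurable.aestronglyMeasurable] at h

omit [DecidableEq m] in
theorem integrable_and_integral_sum_norm_colVec_mul_rpow_le (hr : r ∈ Set.Icc 2 4)
    {Z : m × n → Ω → ℂ} (hind : iIndepFun Z μ) (hZ : ∀ i, MemLp (Z i) (ENNReal.ofReal r) μ)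
    (hZ0 : ∀ i, ∫ ω, Z i ω ∂μ = 0) (hM0 : 0 ≤ M) (hM : ∀ i, ∫ ω, ‖Z i ω‖ ^ r ∂μ ≤ M)
    (B : Matrix m m ℂ) :
    Integrable (fun ω => ∑ j, ‖colVec (B * of fun i j => Z (i, j) ω) j‖ ^ r) μ ∧
      ∫ ω, ∑ j, ‖colVec (B * of fun i j => Z (i, j) ω) j‖ ^ r ∂μ
        ≤ Fintype.card n * (40 * M * (∑ i, ‖colVec B i‖ ^ 2) ^ (r / 2)) := by
  have : IsProbabilityMeasure μ := hind.isProbabilityMeasure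
  simp only [colVec_mul, of_apply]
  have column_integrable (j : n) :
      Integrable (fun ω => ‖∑ k, Z (k, j) ω • colVec B k‖ ^ r) μ := by
    refine integrable_norm_rpow_of_memLp (r := r) ?_ (Set.right_mem_Icc.2 (by linarith [hr.1]))
    exact memLp_finsetSum _ fun k _ =>
      (ContinuousLinearMap.toSpanSingleton ℂ (colVec B k)).comp_memLp' (hZ (k, j))
  refine ⟨integrable_finsetSum _ fun j _ => column_integrable j, ?_⟩
  rw [integral_finsetSum _ fun j _ => column_integrable j]
  refine (Finset.sum_le_card_nsmul _ _ _ fun j _ => ?_).trans_eq (nsmul_eq_mul _ _)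
  exact integral_norm_sum_smul_rpow_le
    (hind.precomp (g := fun k => (k, j)) fun _ _ h => congrArg Prod.fst h)
    (fun k => hZ (k, j)) (fun k => hZ0 (k, j)) hM0 (fun k => hM (k, j)) hr _

theorem integral_comp_prod_eq_of_indepFun [IsFiniteMeasure μ] {α β : Type*} [MeasurableSpace α]
    [MeasurableSpace β] {X : Ω → α} {Y : Ω → β} (hXY : IndepFun X Y μ) (hX : Measurable X)
    (hY : Measurable Y) {Ψ : α × β → ℂ} (hΨ : Measurable Ψ) {C : ℝ} (hC : ∀ q, ‖Ψ q‖ ≤ C) :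
    ∫ ω, Ψ (X ω, Y ω) ∂μ = ∫ ω, ∫ ω', Ψ (X ω, Y ω') ∂μ ∂μ := by
  have law := (indepFun_iff_map_prod_eq_prod_map_map hX.aemeasurable hY.aemeasurable).1 hXY
  have inner_measurable : StronglyMeasurable fun x => ∫ y, Ψ (x, y) ∂μ.map Y :=
    hΨ.stronglyMeasurable.integral_prod_right'
  calc ∫ ω, Ψ (X ω, Y ω) ∂μ = ∫ q, Ψ q ∂(μ.map X).prod (μ.map Y) := by
        rw [← law, integral_map (hX.prodMk hY).aemeasurable hΨ.aestronglyMeasurable]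
    _ = ∫ ω, ∫ y, Ψ (X ω, y) ∂μ.map Y ∂μ := by
        rw [integral_prod _ (.of_bound hΨ.aestronglyMeasurable C (ae_of_all _ hC)),
          integral_map hX.aemeasurable inner_measurable.aestronglyMeasurable]
    _ = ∫ ω, ∫ ω', Ψ (X ω, Y ω') ∂μ ∂μ := by
        refine integral_congr_ae (ae_of_all _ fun ω => ?_)
        exact integral_map hY.aemeasurable (hΨ.comp measurable_prodMk_left).aestronglyMeasurable

theorem norm_integral_resolventAsymmetry_le (hr : r ∈ Set.Icc 2 3)
    {X Y : m × n → Ω → ℂ} (hX_meas : ∀ i, Measurable (X i)) (hY_meas : ∀ i, Measurable (Y i))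
    (hX : iIndepFun X μ) (hY : iIndepFun Y μ)
    (hXY : IndepFun (fun ω i => X i ω) (fun ω i => Y i ω) μ)
    (hX_mem : ∀ i, MemLp (X i) (ENNReal.ofReal r) μ)
    (hY_mem : ∀ i, MemLp (Y i) (ENNReal.ofReal r) μ)
    (hX0 : ∀ i, ∫ ω, X i ω ∂μ = 0) (hY0 : ∀ i, ∫ ω, Y i ω ∂μ = 0) (hM0 : 0 ≤ M)
    (hXM : ∀ i, ∫ ω, ‖X i ω‖ ^ r ∂μ ≤ M) (hYM : ∀ i, ∫ ω, ‖Y i ω‖ ^ r ∂μ ≤ M)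
    (A B : Matrix m m ℂ) :
    ‖∫ ω, resolventAsymmetry
        (skewProduct (A * of fun i j => X (i, j) ω) (B * of fun i j => Y (i, j) ω)) ∂μ‖
      ≤ (Fintype.card m : ℝ)⁻¹ * (2 ^ (r + 1) * M * (∑ i, ‖colVec B i‖ ^ r) *
        (Fintype.card n * (40 * M * (∑ i, ‖colVec A i‖ ^ 2) ^ (r / 2)))) := by
  have : IsProbabilityMeasure μ := hX.isProbabilityMeasure
  obtain ⟨hint, hle⟩ := integrable_and_integral_sum_norm_colVec_mul_rpow_le
    ⟨hr.1, hr.2.trans (by norm_num)⟩ hX hX_mem hX0 hM0 hXM A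
  let Ψ : (m × n → ℂ) × (m × n → ℂ) → ℂ := fun q => resolventAsymmetry
    (skewProduct (A * of fun i j => q.1 (i, j)) (B * of fun i j => q.2 (i, j)))
  have hΨ : Measurable Ψ := measurable_resolventAsymmetry <| measurable_skewProduct_apply
    (measurable_mul_apply (fun _ _ => measurable_const)
      fun i j => (measurable_pi_apply (i, j)).comp measurable_fst)
    (measurable_mul_apply (fun _ _ => measurable_const)
      fun i j => (measurable_pi_apply (i, j)).comp measurable_snd)
  have hfubini := integral_comp_prod_eq_of_indepFun hXY (measurable_pi_lambda _ hX_meas)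
    (measurable_pi_lambda _ hY_meas) hΨ
    fun q => norm_resolventAsymmetry_le_two (skewProduct_mem_skewAdjoint _ _)
  have hinner (ω : Ω) := norm_integral_resolventAsymmetry_le_of_left hr hY hY_mem hY0 hYM
    (A * of fun i j => X (i, j) ω) B
  refine (congrArg norm hfubini).trans_le <| (norm_integral_le_of_norm_le
    ((hint.const_mul _).const_mul _) (ae_of_all _ hinner)).trans ?_
  rw [integral_const_mul, integral_const_mul]
  gcongr

end

end Comparison

section CommutatorMatrix

open Matrix
open scoped MatrixOrder

theorem sum_norm_sq_diag_le {m : Type*} [Fintype m] [DecidableEq m] {G : Matrix m m ℂ}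
    (hG : G.IsHermitian) : ∑ k, ‖G k k‖ ^ 2 ≤ (G ^ 2).trace.re := by
  have sq_apply_self (k : m) : ((G ^ 2) k k).re = ∑ l, ‖G k l‖ ^ 2 := by
    rw [sq, mul_apply, Complex.re_sum]
    refine Finset.sum_congr rfl fun l _ => ?_
    rw [← hG.apply l k, Complex.star_def, Complex.mul_conj, Complex.ofReal_re,
      Complex.normSq_eq_norm_sq]
  rw [trace, Complex.re_sum]
  refine Finset.sum_le_sum fun k _ => ?_
  rw [diag_apply, sq_apply_self]
  exact Finset.single_le_sum (f := fun l => ‖G k l‖ ^ 2) (fun _ _ => sq_nonneg _)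
    (Finset.mem_univ k)

theorem sum_norm_colVec_rpow_le {l m : Type*} [Fintype l] [Fintype m] [DecidableEq m]
    (B : Matrix l m ℂ) {r : ℝ} (hr : r ∈ Set.Icc 0 4) :
    ∑ k, ‖colVec B k‖ ^ r ≤ Fintype.card m + ((Bᴴ * B) ^ 2).trace.re := by
  have norm_sq_eq (k : m) : ‖(Bᴴ * B) k k‖ = ‖colVec B k‖ ^ 2 := by
    have : (Bᴴ * B) k k = ((‖colVec B k‖ ^ 2 : ℝ) : ℂ) := by
      simp [mul_apply, colVec, EuclideanSpace.norm_sq_eq, Complex.conj_mul']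
    rw [this, Complex.norm_real, Real.norm_of_nonneg (sq_nonneg _)]
  have rpow_le {y : ℝ} (hy : 0 ≤ y) : y ^ r ≤ 1 + (y ^ 2) ^ 2 := by
    rcases le_total y 1 with h | h
    · exact (Real.rpow_le_one hy h hr.1).trans (le_add_of_nonneg_right (by positivity))
    · rw [← pow_mul, ← Real.rpow_natCast]
      exact (Real.rpow_le_rpow_of_exponent_le h (by simpa using hr.2)).trans
        (le_add_of_nonneg_left zero_le_one)
  calc ∑ k, ‖colVec B k‖ ^ r ≤ ∑ k, (1 + ‖(Bᴴ * B) k k‖ ^ 2) :=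
        Finset.sum_le_sum fun k _ => (rpow_le (norm_nonneg _)).trans_eq (by rw [norm_sq_eq])
    _ = Fintype.card m + ∑ k, ‖(Bᴴ * B) k k‖ ^ 2 := by simp [Finset.sum_add_distrib]
    _ ≤ _ := by gcongr; exact sum_norm_sq_diag_le (isHermitian_conjTranspose_mul_self B)

variable {p n : ℕ}

theorem psdSqrt_conjTranspose_mul_self {A : Matrix (Fin p) (Fin p) ℂ} (hA : A.PosSemidef) :
    (psdSqrt A)ᴴ * psdSqrt A = A := by
  rw [psdSqrt, (CFC.sqrt_nonneg A).posSemidef.isHermitian]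
  exact CFC.sqrt_mul_sqrt_self A hA.nonneg

open scoped Matrix.Norms.L2Operator in
theorem measurable_psdSqrt_apply {α : Type*} [MeasurableSpace α]
    {A : α → Matrix (Fin p) (Fin p) ℂ} (hA : ∀ i j, Measurable fun a => A a i j) (i j : Fin p) :
    Measurable fun a => psdSqrt (A a) i j := by
  classical
  set P : Set (Fin p → Fin p → ℂ) := {M | 0 ≤ of M}
  set f : (Fin p → Fin p → ℂ) → ℂ := fun M => psdSqrt (of M) i j
  have isClosed_P : IsClosed P := isClosed_le continuous_const continuous_id
  have continuousOn_f : ContinuousOn f P :=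
    (Continuous.matrix_elem continuous_id i j).comp_continuousOn
      (CFC.continuousOn_sqrt (A := Matrix (Fin p) (Fin p) ℂ))
  have f_eq : f = P.piecewise f 0 := by
    ext M
    by_cases hM : M ∈ P
    · simp [hM]
    · have not_nonneg : ¬(0 : Matrix (Fin p) (Fin p) ℂ) ≤ of M := hM
      simp [hM, f, psdSqrt, CFC.sqrt_of_not_nonneg not_nonneg]
  have measurable_f : Measurable f :=
    f_eq ▸ continuousOn_f.measurable_piecewise continuousOn_const isClosed_P.measurableSet
  exact measurable_f.comp (measurable_pi_lambda _ fun i => measurable_pi_lambda _ fun j => hA i j)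

theorem smul_commutatorMatrix (s : ℝ) (S : Fin 2 → Matrix (Fin p) (Fin p) ℂ)
    (Z : Fin 2 → Matrix (Fin p) (Fin n) ℂ) :
    s • commutatorMatrix S Z
      = skewProduct (((s / n) • psdSqrt (S 0)) * Z 0) (psdSqrt (S 1) * Z 1) := by
  have hcast : (n : ℂ)⁻¹ = ((n : ℝ)⁻¹ : ℝ) := by push_cast; rfl
  rw [Matrix.smul_mul, ← smul_skewProduct, div_eq_mul_inv, mul_smul, commutatorMatrix, hcast,
    Complex.coe_smul]
  rfl

theorem commutatorMatrix_mem_skewAdjoint (S : Fin 2 → Matrix (Fin p) (Fin p) ℂ)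
    (Z : Fin 2 → Matrix (Fin p) (Fin n) ℂ) :
    commutatorMatrix S Z ∈ skewAdjoint (Matrix (Fin p) (Fin p) ℂ) := by
  rw [← one_smul ℝ (commutatorMatrix S Z), smul_commutatorMatrix]
  exact skewProduct_mem_skewAdjoint _ _

theorem measurable_commutatorMatrix_apply {α : Type*} [MeasurableSpace α]
    {S : α → Fin 2 → Matrix (Fin p) (Fin p) ℂ} {Z : α → Fin 2 → Matrix (Fin p) (Fin n) ℂ}
    (hS : ∀ k i j, Measurable fun a => S a k i j) (hZ : ∀ k i j, Measurable fun a => Z a k i j)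
    (i j : Fin p) : Measurable fun a => commutatorMatrix (S a) (Z a) i j :=
  (measurable_skewProduct_apply
    (measurable_mul_apply (measurable_psdSqrt_apply (hS 0)) (hZ 0))
    (measurable_mul_apply (measurable_psdSqrt_apply (hS 1)) (hZ 1)) i j).const_mul (n : ℂ)⁻¹

variable {Ω : Type*} [MeasurableSpace Ω] {μ : Measure Ω} {r M D : ℝ}

theorem indepFun_blocks_of_iIndepFun {κ ι β : Type*} [Finite ι] [MeasurableSpace β]
    {X : κ × ι → Ω → β} (hind : iIndepFun X μ) (hX : ∀ x, Measurable (X x)) {k k' : κ}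
    (hk : k ≠ k') : IndepFun (fun ω i => X (k, i) ω) (fun ω i => X (k', i) ω) μ := by
  classical
  have := Fintype.ofFinite ι
  let block (k : κ) : Finset (κ × ι) := Finset.univ.image fun i => (k, i)
  have mem_block (k : κ) (i : ι) : (k, i) ∈ block k := Finset.mem_image_of_mem _ (Finset.mem_univ i)
  have block_disjoint : Disjoint (block k) (block k') := by
    simp [block, Finset.disjoint_left, hk.symm]
  exact (hind.indepFun_finset _ _ block_disjoint hX).comp
    (φ := fun y i => y ⟨(k, i), mem_block k i⟩) (ψ := fun y i => y ⟨(k', i), mem_block k' i⟩)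
    (by fun_prop) (by fun_prop)

theorem norm_integral_resolventAsymmetry_commutatorMatrix_le (hr : r ∈ Set.Icc 2 3)
    {Z : Ω → Fin 2 → Matrix (Fin p) (Fin n) ℂ} (hZ_meas : ∀ k i j, Measurable fun ω => Z ω k i j)
    (hind : iIndepFun (fun (x : Fin 2 × Fin p × Fin n) ω => Z ω x.1 x.2.1 x.2.2) μ)
    (hZ : ∀ k i j, MemLp (fun ω => Z ω k i j) (ENNReal.ofReal r) μ)
    (hZ0 : ∀ k i j, ∫ ω, Z ω k i j ∂μ = 0) (hM : ∀ k i j, ∫ ω, ‖Z ω k i j‖ ^ r ∂μ ≤ M)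
    (hM0 : 0 ≤ M) {S : Fin 2 → Matrix (Fin p) (Fin p) ℂ} (hS : ∀ k, (S k).PosSemidef)
    (hD0 : 0 ≤ D) (hD : ∀ k, ((S k) ^ 2).trace.re ≤ p * D) (s : ℝ) :
    ‖∫ ω, resolventAsymmetry (s • commutatorMatrix S (Z ω)) ∂μ‖
      ≤ 2 ^ (r + 1) * M * (1 + D) * (n * (40 * M * (|s| / n) ^ r * (p * (1 + D)) ^ (r / 2))) := by
  have column_sum_le {a : ℝ} (ha : a ∈ Set.Icc 0 4) (k : Fin 2) :
      ∑ i, ‖colVec (psdSqrt (S k)) i‖ ^ a ≤ p * (1 + D) := by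
    refine (sum_norm_colVec_rpow_le _ ha).trans ?_
    rw [psdSqrt_conjTranspose_mul_self (hS k), Fintype.card_fin, mul_one_add]
    gcongr
    exact hD k
  have scaled_column_sum_le : (∑ i, ‖colVec ((s / n) • psdSqrt (S 0)) i‖ ^ 2) ^ (r / 2)
      ≤ (|s| / n) ^ r * (p * (1 + D)) ^ (r / 2) := by
    have norm_sq_eq (i : Fin p) : ‖colVec ((s / n) • psdSqrt (S 0)) i‖ ^ 2
        = (|s| / n) ^ 2 * ‖colVec (psdSqrt (S 0)) i‖ ^ (2 : ℝ) := by
      rw [colVec_smul, norm_smul, mul_pow, Real.norm_eq_abs, abs_div, Nat.abs_cast,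
        Real.rpow_two]
    have hpow : ((|s| / n) ^ 2) ^ (r / 2) = (|s| / n) ^ r := by
      rw [← Real.rpow_natCast_mul (by positivity)]
      congr 1; push_cast; ring
    simp only [norm_sq_eq, ← Finset.mul_sum]
    rw [Real.mul_rpow (by positivity) (by positivity), hpow]
    gcongr
    · linarith [hr.1]
    · exact column_sum_le (by norm_num) 0
  have block_indep : IndepFun (fun ω (x : Fin p × Fin n) => Z ω 0 x.1 x.2)
      (fun ω (x : Fin p × Fin n) => Z ω 1 x.1 x.2) μ :=
    indepFun_blocks_of_iIndepFun hind (fun x => hZ_meas _ _ _) zero_ne_one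
  have block_iIndep (k : Fin 2) : iIndepFun (fun (x : Fin p × Fin n) ω => Z ω k x.1 x.2) μ :=
    hind.precomp (g := fun x => (k, x)) fun _ _ h => congrArg Prod.snd h
  simp only [smul_commutatorMatrix]
  refine (norm_integral_resolventAsymmetry_le hr (X := fun x ω => Z ω 0 x.1 x.2)
    (Y := fun x ω => Z ω 1 x.1 x.2) (fun x => hZ_meas _ _ _) (fun x => hZ_meas _ _ _)
    (block_iIndep 0) (block_iIndep 1) block_indep (fun x => hZ _ _ _) (fun x => hZ _ _ _)
    (fun x => hZ0 _ _ _) (fun x => hZ0 _ _ _) hM0 (fun x => hM _ _ _) (fun x => hM _ _ _)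
    _ _).trans ?_
  rw [Fintype.card_fin, Fintype.card_fin]
  calc (p : ℝ)⁻¹ * (2 ^ (r + 1) * M * (∑ i, ‖colVec (psdSqrt (S 1)) i‖ ^ r) *
        (n * (40 * M * (∑ i, ‖colVec ((s / n) • psdSqrt (S 0)) i‖ ^ 2) ^ (r / 2))))
      ≤ (p : ℝ)⁻¹ * (2 ^ (r + 1) * M * (p * (1 + D)) *
        (n * (40 * M * ((|s| / n) ^ r * (p * (1 + D)) ^ (r / 2))))) := by
        gcongr
        exact column_sum_le ⟨by linarith [hr.1], by linarith [hr.2]⟩ 1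
    _ = ((p : ℝ)⁻¹ * p) * (2 ^ (r + 1) * M * (1 + D) *
        (n * (40 * M * (|s| / n) ^ r * (p * (1 + D)) ^ (r / 2)))) := by ring
    _ ≤ _ := mul_le_of_le_one_left (by positivity) inv_mul_le_one

end CommutatorMatrix

section Uniqueness

theorem norm_resolventKernel_pow_mul_le_one (y y' : ℝ) (k : ℕ) :
    ‖resolventKernel y ^ k * resolventKernel y'‖ ≤ 1 := by
  rw [norm_mul, norm_pow]
  exact mul_le_one₀ (pow_le_one₀ (norm_nonneg _) (norm_resolventKernel_le_one y)) (norm_nonneg _)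
    (norm_resolventKernel_le_one y')

theorem integrable_resolventKernel_pow_mul (μ : Measure ℝ) [IsFiniteMeasure μ] (s t : ℝ) (k : ℕ) :
    Integrable (fun x => resolventKernel (s * x) ^ k * resolventKernel (t * x)) μ :=
  have := continuous_resolventKernel
  .of_bound (by fun_prop) 1 (ae_of_all _ fun _ => norm_resolventKernel_pow_mul_le_one _ _ k)

theorem continuous_integral_resolventKernel_pow_mul (μ : Measure ℝ) [IsFiniteMeasure μ] (s : ℝ)
    (k : ℕ) :
    Continuous fun t => ∫ x, resolventKernel (s * x) ^ k * resolventKernel (t * x) ∂μ :=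
  have := continuous_resolventKernel
  continuous_of_dominated (bound := fun _ => 1) (fun t => by fun_prop)
    (fun _ => ae_of_all _ fun _ => norm_resolventKernel_pow_mul_le_one _ _ k)
    (integrable_const _) (ae_of_all _ fun x => by fun_prop)

theorem sub_mul_resolventKernel_mul (s t x : ℝ) :
    ((s - t : ℝ) : ℂ) * (resolventKernel (s * x) * resolventKernel (t * x))
      = s * resolventKernel (s * x) - t * resolventKernel (t * x) := by
  have hs := one_sub_ofReal_mul_I_ne_zero (s * x)
  have ht := one_sub_ofReal_mul_I_ne_zero (t * x)
  push_cast [resolventKernel] at hs ht ⊢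
  field_simp
  ring

theorem tendsto_integral_resolventKernel_pow_charFun (μ : Measure ℝ) [IsFiniteMeasure μ] (t : ℝ) :
    Tendsto (fun k : ℕ => ∫ x, resolventKernel (t / k * x) ^ k ∂μ) atTop (𝓝 (charFun μ t)) := by
  have := continuous_resolventKernel
  rw [charFun_apply_real]
  refine tendsto_integral_of_dominated_convergence (fun _ => 1) (fun k => by fun_prop)
    (integrable_const _) (fun k => ae_of_all _ fun x => ?_) (ae_of_all _ fun x => ?_)
  · rw [norm_pow]
    exact pow_le_one₀ (norm_nonneg _) (norm_resolventKernel_le_one _)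
  · have h := (Complex.tendsto_one_add_div_pow_exp (-(t * x * Complex.I))).inv₀
      (Complex.exp_ne_zero _)
    rw [← Complex.exp_neg, neg_neg] at h
    refine h.congr fun k => ?_
    rw [resolventKernel, inv_pow]
    congr 2
    push_cast
    ring

variable {μ ν : Measure ℝ} [IsFiniteMeasure μ] [IsFiniteMeasure ν]

/- By the resolvent identity the hypothesis passes from `s` to pairs `s ≠ t`, and by continuity to
`s = t`; this raises the power of the kernel by one. -/
theorem integral_resolventKernel_pow_mul_eq
    (h : ∀ s, ∫ x, resolventKernel (s * x) ∂μ = ∫ x, resolventKernel (s * x) ∂ν) (k : ℕ) (s t : ℝ) :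
    ∫ x, resolventKernel (s * x) ^ k * resolventKernel (t * x) ∂μ
      = ∫ x, resolventKernel (s * x) ^ k * resolventKernel (t * x) ∂ν := by
  induction k generalizing t with
  | zero => simpa using h t
  | succ k ih =>
    have integral_eq (ρ : Measure ℝ) [IsFiniteMeasure ρ] (t : ℝ) :
        ((s - t : ℝ) : ℂ) * ∫ x, resolventKernel (s * x) ^ (k + 1) * resolventKernel (t * x) ∂ρ
          = s * ∫ x, resolventKernel (s * x) ^ k * resolventKernel (s * x) ∂ρ
            - t * ∫ x, resolventKernel (s * x) ^ k * resolventKernel (t * x) ∂ρ := by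
      have integrable (t : ℝ) := integrable_resolventKernel_pow_mul ρ s t k
      rw [← integral_const_mul, ← integral_const_mul, ← integral_const_mul,
        ← integral_sub ((integrable s).const_mul _) ((integrable t).const_mul _)]
      congr with x
      linear_combination resolventKernel (s * x) ^ k * sub_mul_resolventKernel_mul s t x
    refine congrFun ((continuous_integral_resolventKernel_pow_mul μ s (k + 1)).ext_on
      (dense_compl_singleton s) (continuous_integral_resolventKernel_pow_mul ν s (k + 1))
      fun t ht => ?_) t
    have hst : ((s - t : ℝ) : ℂ) ≠ 0 := by exact_mod_cast sub_ne_zero.2 (Ne.symm ht)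
    exact mul_left_cancel₀ hst (by rw [integral_eq μ, integral_eq ν, ih s, ih t])

theorem ext_of_integral_resolventKernel
    (h : ∀ s, ∫ x, resolventKernel (s * x) ∂μ = ∫ x, resolventKernel (s * x) ∂ν) : μ = ν := by
  refine Measure.ext_of_charFun (funext fun t => ?_)
  have hμ := tendsto_integral_resolventKernel_pow_charFun μ t
  have hν := tendsto_integral_resolventKernel_pow_charFun ν t
  refine tendsto_nhds_unique (hμ.congr' ?_) hν
  filter_upwards [eventually_ge_atTop 1] with k hk
  obtain ⟨k, rfl⟩ := Nat.exists_eq_add_of_le' hk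
  simp only [pow_succ]
  exact integral_resolventKernel_pow_mul_eq h k _ (t / (k + 1 : ℕ))

end Uniqueness

section Spectral

theorem toMeasure_empiricalMeasure_map_univ {ι E : Type*} [Fintype ι] [MeasurableSpace E]
    (g : ι → E) :
    (empiricalMeasure (Finset.univ.val.map g) : Measure E)
      = (Fintype.card ι : ℝ≥0)⁻¹ • ∑ i, Measure.dirac (g i) := by
  rw [empiricalMeasure, FiniteMeasure.toMeasure_smul, Multiset.card_map, Multiset.map_map]
  exact congrArg _ (map_sum FiniteMeasure.toMeasureAddMonoidHom
    (fun i => (diracProba (g i)).toFiniteMeasure) Finset.univ)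

theorem integral_empiricalMeasure_map_univ {ι E : Type*} [Fintype ι] [MeasurableSpace E]
    [MeasurableSingletonClass E] (g : ι → E) (φ : E → ℂ) :
    ∫ x, φ x ∂(empiricalMeasure (Finset.univ.val.map g) : Measure E)
      = (Fintype.card ι : ℂ)⁻¹ * ∑ i, φ (g i) := by
  rw [toMeasure_empiricalMeasure_map_univ, integral_smul_nnreal_measure,
    integral_finsetSum_measure fun i _ => integrable_dirac (by simp)]
  simp [NNReal.smul_def]

theorem integral_esd_resolventKernel {p : ℕ} {A : Matrix (Fin p) (Fin p) ℂ}
    (hA : A ∈ skewAdjoint (Matrix (Fin p) (Fin p) ℂ)) (s : ℝ) :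
    ∫ z, resolventKernel (s * z.im) ∂(esd A : Measure ℂ) = resolventTrace (s • A) := by
  obtain ⟨U, d, rfl⟩ := exists_eq_conj_diagonal hA
  have smul_eq : s • Unitary.conjStarAlgAut ℂ _ U (Matrix.diagonal fun i => (d i : ℂ) * Complex.I)
      = Unitary.conjStarAlgAut ℂ _ U
          (Matrix.diagonal fun i => ((s * d i : ℝ) : ℂ) * Complex.I) := by
    rw [← Complex.coe_smul, ← map_smul, ← Matrix.diagonal_smul]
    congr! 3 with i
    simp [mul_assoc]
  rw [smul_eq, resolventTrace_conj_diagonal, esd, roots_charpoly_conj_diagonal,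
    integral_empiricalMeasure_map_univ]
  simp

theorem map_im_mul_I_esd {p : ℕ} {A : Matrix (Fin p) (Fin p) ℂ}
    (hA : A ∈ skewAdjoint (Matrix (Fin p) (Fin p) ℂ)) :
    (esd A).map (fun z => z.im * Complex.I) = esd A := by
  obtain ⟨U, d, rfl⟩ := exists_eq_conj_diagonal hA
  have ae_re_eq_zero : ∀ᵐ z ∂(esd (Unitary.conjStarAlgAut ℂ _ U
      (Matrix.diagonal fun i => (d i : ℂ) * Complex.I)) : Measure ℂ), z.re = 0 := by
    rw [esd, roots_charpoly_conj_diagonal, toMeasure_empiricalMeasure_map_univ, ae_iff]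
    simp
  refine FiniteMeasure.toMeasure_injective ?_
  rw [FiniteMeasure.toMeasure_map]
  calc _ = Measure.map id _ := Measure.map_congr <| ae_re_eq_zero.mono fun z hz => by
        apply Complex.ext <;> simp [hz]
    _ = _ := Measure.map_id

theorem integrable_resolventTrace_smul {Ω m : Type*} [MeasurableSpace Ω] {μ : Measure Ω}
    [IsFiniteMeasure μ] [Fintype m] [DecidableEq m] {A : Ω → Matrix m m ℂ}
    (hA_meas : ∀ i j, Measurable fun ω => A ω i j)
    (hA : ∀ ω, A ω ∈ skewAdjoint (Matrix m m ℂ)) (s : ℝ) :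
    Integrable (fun ω => resolventTrace (s • A ω)) μ :=
  .of_bound (measurable_resolventTrace fun i j => (hA_meas i j).const_smul s).aestronglyMeasurable 1
    (ae_of_all _ fun ω => norm_resolventTrace_le_one (skewAdjoint.smul_mem s (hA ω)))

variable {Ω : Type*} [MeasurableSpace Ω] {μ : Measure Ω} [IsProbabilityMeasure μ] {p : ℕ → ℕ}
  {A : (n : ℕ) → Ω → Matrix (Fin (p n)) (Fin (p n)) ℂ} {F : ProbabilityMeasure ℂ}

theorem IsLSD.map_im_mul_I_eq_self (hF : IsLSD μ A F)
    (hA : ∀ n ω, A n ω ∈ skewAdjoint (Matrix (Fin (p n)) (Fin (p n)) ℂ)) :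
    (F : Measure ℂ).map (fun z => z.im * Complex.I) = F := by
  obtain ⟨ω, hω⟩ := Eventually.exists hF
  have h := FiniteMeasure.tendsto_map_of_tendsto_of_continuous _ _ hω
    (f := fun z => z.im * Complex.I) (by fun_prop)
  simp only [map_im_mul_I_esd (hA _ ω)] at h
  exact congrArg FiniteMeasure.toMeasure (tendsto_nhds_unique h hω)

theorem IsLSD.tendsto_integral_resolventTrace (hF : IsLSD μ A F)
    (hA_meas : ∀ n i j, Measurable fun ω => A n ω i j)
    (hA : ∀ n ω, A n ω ∈ skewAdjoint (Matrix (Fin (p n)) (Fin (p n)) ℂ)) (s : ℝ) :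
    Tendsto (fun n => ∫ ω, resolventTrace (s • A n ω) ∂μ) atTop
      (𝓝 (∫ z, resolventKernel (s * z.im) ∂(F : Measure ℂ))) := by
  let kernel : BoundedContinuousFunction ℂ ℂ := .ofNormedAddCommGroup
    (fun z => resolventKernel (s * z.im)) (continuous_resolventKernel.comp (by fun_prop)) 1
    fun _ => norm_resolventKernel_le_one _
  have ae_tendsto : ∀ᵐ ω ∂μ, Tendsto (fun n => resolventTrace (s • A n ω)) atTop
      (𝓝 (∫ z, resolventKernel (s * z.im) ∂(F : Measure ℂ))) := by
    filter_upwards [hF] with ω hω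
    simp only [← integral_esd_resolventKernel (hA _ ω)]
    exact (FiniteMeasure.tendsto_iff_forall_integral_rclike_tendsto ℂ).1 hω kernel
  have h := tendsto_integral_of_dominated_convergence (fun _ => 1)
    (fun n => (integrable_resolventTrace_smul (hA_meas n) (hA n) s).aestronglyMeasurable)
    (integrable_const _)
    (fun n => ae_of_all _ fun ω => norm_resolventTrace_le_one (skewAdjoint.smul_mem s (hA n ω)))
    ae_tendsto
  simpa only [integral_const, probReal_univ, one_smul] using h

theorem IsLSD.map_neg_eq_self (hF : IsLSD μ A F)
    (hA_meas : ∀ n i j, Measurable fun ω => A n ω i j)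
    (hA : ∀ n ω, A n ω ∈ skewAdjoint (Matrix (Fin (p n)) (Fin (p n)) ℂ))
    (h : ∀ s : ℝ, Tendsto (fun n => ∫ ω, resolventAsymmetry (s • A n ω) ∂μ) atTop (𝓝 0)) :
    (F : Measure ℂ).map (fun z => -z) = F := by
  have := continuous_resolventKernel
  have transform_even (s : ℝ) : ∫ z, resolventKernel (s * z.im) ∂(F : Measure ℂ)
      = ∫ z, resolventKernel (-s * z.im) ∂(F : Measure ℂ) := by
    have hs := h s
    simp only [resolventAsymmetry, ← neg_smul,
      integral_sub (integrable_resolventTrace_smul (hA_meas _) (hA _) _)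
        (integrable_resolventTrace_smul (hA_meas _) (hA _) _)] at hs
    have hlim := (hF.tendsto_integral_resolventTrace hA_meas hA s).sub
      (hF.tendsto_integral_resolventTrace hA_meas hA (-s))
    exact sub_eq_zero.1 (tendsto_nhds_unique hlim hs)
  have map_im_symm : (F : Measure ℂ).map (fun z => -z.im) = (F : Measure ℂ).map Complex.im :=
    ext_of_integral_resolventKernel fun s => by
      rw [integral_map (by fun_prop) (by fun_prop), integral_map (by fun_prop) (by fun_prop),
        transform_even]
      simp
  have map_im_mul_I_eq := hF.map_im_mul_I_eq_self hA
  calc (F : Measure ℂ).map (fun z => -z)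
      = ((F : Measure ℂ).map (fun z => z.im * Complex.I)).map (fun z => -z) := by
        rw [map_im_mul_I_eq]
    _ = ((F : Measure ℂ).map fun z => -z.im).map (fun y : ℝ => (y : ℂ) * Complex.I) := by
        rw [Measure.map_map (by fun_prop) (by fun_prop),
          Measure.map_map (by fun_prop) (by fun_prop)]
        congr 1; ext z; simp
    _ = F := by
        rw [map_im_symm, Measure.map_map (by fun_prop) (by fun_prop)]
        exact map_im_mul_I_eq

end Spectral

section Asymptotics

theorem memLp_and_integral_norm_rpow_le {Ω E : Type*} [MeasurableSpace Ω] {μ : Measure Ω}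
    [IsProbabilityMeasure μ] [NormedAddCommGroup E] {X : Ω → E} (hX : AEStronglyMeasurable X μ)
    {a b : ℝ} (ha : 0 < a) (hab : a ≤ b) {B : ℝ≥0∞} (hB : B < ∞) (h : ∫⁻ ω, ‖X ω‖ₑ ^ b ∂μ ≤ B) :
    MemLp X (ENNReal.ofReal a) μ ∧ ∫ ω, ‖X ω‖ ^ a ∂μ ≤ B.toReal ^ (a / b) := by
  have hb : 0 < b := ha.trans_le hab
  have memLp : MemLp X (ENNReal.ofReal b) μ := by
    refine ⟨hX, (eLpNorm_lt_top_iff_lintegral_rpow_enorm_lt_top (by simpa) (by simp)).2 ?_⟩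
    rw [ENNReal.toReal_ofReal hb.le]
    exact h.trans_lt hB
  refine ⟨memLp.mono_exponent (ENNReal.ofReal_le_ofReal hab),
    (integral_norm_rpow_le_rpow memLp hb ⟨ha.le, hab⟩).trans ?_⟩
  gcongr
  rw [integral_eq_lintegral_of_nonneg_ae (ae_of_all _ fun ω => by positivity)
    (hX.norm.aemeasurable.pow_const b).aestronglyMeasurable]
  refine ENNReal.toReal_mono hB.ne (le_trans (lintegral_mono fun ω => ?_) h)
  rw [← ENNReal.ofReal_rpow_of_nonneg (norm_nonneg _) hb.le, ofReal_norm]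

variable {p : ℕ → ℕ}

theorem tendsto_mul_div_rpow_mul_rpow (hp : (fun n => (p n : ℝ)) =O[atTop] fun n => (n : ℝ))
    {a b r : ℝ} (ha : 0 ≤ a) (hr : 2 < r) :
    Tendsto (fun n : ℕ => n * ((a / n) ^ r * (p n * b) ^ (r / 2))) atTop (𝓝 0) := by
  have rpow_isBigO : (fun n => ((p n : ℝ) * b) ^ (r / 2)) =O[atTop] fun n => (n : ℝ) ^ (r / 2) :=
    Asymptotics.IsBigO.rpow (by linarith) (Eventually.of_forall fun n => n.cast_nonneg)
      (by simpa using hp.mul (Asymptotics.isBigO_const_const b (one_ne_zero (α := ℝ)) atTop))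
  have hlim : Tendsto (fun n : ℕ => a ^ r * (n : ℝ) ^ (-(r / 2 - 1))) atTop (𝓝 0) := by
    simpa using ((tendsto_rpow_neg_atTop (by linarith : 0 < r / 2 - 1)).comp
      (tendsto_natCast_atTop_atTop (R := ℝ))).const_mul (a ^ r)
  refine Asymptotics.IsBigO.trans_tendsto ?_ hlim
  refine (((Asymptotics.isBigO_refl (fun n : ℕ => (n : ℝ) * (a / n) ^ r) atTop).mul
    rpow_isBigO).congr' (.of_forall fun n => by ring) ?_)
  filter_upwards [eventually_gt_atTop 0] with n hn
  have hn : (0 : ℝ) < n := by exact_mod_cast hn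
  rw [Real.div_rpow ha hn.le, neg_sub, Real.rpow_sub hn, Real.rpow_one]
  have : (n : ℝ) ^ r = (n : ℝ) ^ (r / 2) * (n : ℝ) ^ (r / 2) := by
    rw [← Real.rpow_add hn, add_halves]
  rw [this]
  field_simp

theorem exists_eventually_trace_sq_le {κ : Type*} [Finite κ]
    {S : (n : ℕ) → κ → Matrix (Fin (p n)) (Fin (p n)) ℂ}
    (hS : ∀ k, IsBoundedUnder (· ≤ ·) atTop fun n => (p n : ℝ)⁻¹ * ((S n k) ^ 2).trace.re) :
    ∃ D : ℝ, 0 ≤ D ∧ ∀ᶠ n in atTop, ∀ k, ((S n k) ^ 2).trace.re ≤ p n * D := by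
  choose D hD using hS
  obtain ⟨B, hB⟩ := Set.finite_range D |>.bddAbove
  refine ⟨max B 0, le_max_right _ _, eventually_all.2 fun k => ?_⟩
  filter_upwards [hD k] with n hn
  rcases Nat.eq_zero_or_pos (p n) with h0 | hpos
  · have : IsEmpty (Fin (p n)) := by rw [h0]; infer_instance
    simp [Matrix.trace, h0]
  · rw [← inv_mul_le_iff₀ (by exact_mod_cast hpos)]
    exact hn.trans ((hB (Set.mem_range_self k)).trans (le_max_left _ _))

variable {Ω : Type*} [MeasurableSpace Ω] {μ : Measure Ω} [IsProbabilityMeasure μ]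
  {Z : (n : ℕ) → Ω → Fin 2 → Matrix (Fin (p n)) (Fin n) ℂ} {η : ℝ}

theorem tendsto_integral_resolventAsymmetry_commutatorMatrix
    (hp : (fun n => (p n : ℝ)) =O[atTop] fun n => (n : ℝ))
    (hZ_meas : ∀ n k i j, Measurable fun ω => Z n ω k i j)
    (hind : ∀ n, iIndepFun (fun (x : Fin 2 × Fin (p n) × Fin n) ω => Z n ω x.1 x.2.1 x.2.2) μ)
    (hZ0 : ∀ n k i j, ∫ ω, Z n ω k i j ∂μ = 0) (hη : 0 < η)
    (hZ : (⨆ (n) (k) (i) (j), ∫⁻ ω, ‖Z n ω k i j‖ₑ ^ (2 + η) ∂μ) < ∞)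
    {S : (n : ℕ) → Fin 2 → Matrix (Fin (p n)) (Fin (p n)) ℂ} (hS : ∀ n k, (S n k).PosSemidef)
    (hS2 : ∀ k, IsBoundedUnder (· ≤ ·) atTop fun n => (p n : ℝ)⁻¹ * ((S n k) ^ 2).trace.re)
    (s : ℝ) :
    Tendsto (fun n => ∫ ω, resolventAsymmetry (s • commutatorMatrix (S n) (Z n ω)) ∂μ) atTop
      (𝓝 0) := by
  obtain ⟨r, ⟨hr2, hr3⟩, hrη⟩ : ∃ r : ℝ, r ∈ Set.Ioc 2 3 ∧ r ≤ 2 + η :=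
    ⟨2 + min η 1, ⟨by simp [hη], by linarith [min_le_right η 1]⟩, by simp⟩
  obtain ⟨M, hM0, hM⟩ : ∃ M : ℝ, 0 ≤ M ∧ ∀ n k i j,
      MemLp (fun ω => Z n ω k i j) (ENNReal.ofReal r) μ ∧ ∫ ω, ‖Z n ω k i j‖ ^ r ∂μ ≤ M :=
    ⟨_, Real.rpow_nonneg ENNReal.toReal_nonneg _, fun n k i j =>
      memLp_and_integral_norm_rpow_le (hZ_meas n k i j).aestronglyMeasurable (by linarith) hrη hZ
        (le_iSup_of_le n <| le_iSup_of_le k <| le_iSup_of_le i <|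
          le_iSup (fun j => ∫⁻ ω, ‖Z n ω k i j‖ₑ ^ (2 + η) ∂μ) j)⟩
  obtain ⟨D, hD0, hD⟩ := exists_eventually_trace_sq_le hS2
  have bound_tendsto := ((tendsto_mul_div_rpow_mul_rpow hp (b := 1 + D) (abs_nonneg s)
    hr2).const_mul (40 * M)).const_mul (2 ^ (r + 1) * M * (1 + D))
  rw [mul_zero, mul_zero] at bound_tendsto
  refine squeeze_zero_norm' (hD.mono fun n hDn => ?_) bound_tendsto
  refine (norm_integral_resolventAsymmetry_commutatorMatrix_le ⟨hr2.le, hr3⟩ (hZ_meas n) (hind n)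
    (fun k i j => (hM n k i j).1) (hZ0 n) (fun k i j => (hM n k i j).2) hM0 (hS n) hD0 hDn
    s).trans_eq ?_
  ring

theorem integral_resolventAsymmetry_commutatorMatrix_eq_of_indepFun {m n : ℕ}
    {S : Ω → Fin 2 → Matrix (Fin m) (Fin m) ℂ} {Z : Ω → Fin 2 → Matrix (Fin m) (Fin n) ℂ}
    (hS : ∀ k i j, Measurable fun ω => S ω k i j) (hZ : ∀ k i j, Measurable fun ω => Z ω k i j)
    (hSZ : IndepFun (fun ω (x : Fin 2 × Fin m × Fin m) => S ω x.1 x.2.1 x.2.2)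
      (fun ω (x : Fin 2 × Fin m × Fin n) => Z ω x.1 x.2.1 x.2.2) μ) (s : ℝ) :
    ∫ ω, resolventAsymmetry (s • commutatorMatrix (S ω) (Z ω)) ∂μ
      = ∫ ω, ∫ ω', resolventAsymmetry (s • commutatorMatrix (S ω) (Z ω')) ∂μ ∂μ := by
  have hΨ : Measurable fun q : (Fin 2 × Fin m × Fin m → ℂ) × (Fin 2 × Fin m × Fin n → ℂ) =>
      resolventAsymmetry (s • commutatorMatrix (fun k => .of fun i j => q.1 (k, i, j))
        (fun k => .of fun i j => q.2 (k, i, j))) :=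
    measurable_resolventAsymmetry fun i j => (measurable_commutatorMatrix_apply
      (fun k i j => by simp only [Matrix.of_apply]; fun_prop)
      (fun k i j => by simp only [Matrix.of_apply]; fun_prop) i j).const_smul s
  have h := integral_comp_prod_eq_of_indepFun hSZ (measurable_pi_lambda _ fun x => hS _ _ _)
    (measurable_pi_lambda _ fun x => hZ _ _ _) hΨ fun q => norm_resolventAsymmetry_le_two
      (skewAdjoint.smul_mem s (commutatorMatrix_mem_skewAdjoint _ _))
  exact h

theorem tendsto_integral_resolventAsymmetry_commutatorMatrix_of_indepFun
    (hp : (fun n => (p n : ℝ)) =O[atTop] fun n => (n : ℝ))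
    {S : (n : ℕ) → Ω → Fin 2 → Matrix (Fin (p n)) (Fin (p n)) ℂ}
    (hS_meas : ∀ n k i j, Measurable fun ω => S n ω k i j)
    (hZ_meas : ∀ n k i j, Measurable fun ω => Z n ω k i j)
    (hS : ∀ n, ∀ᵐ ω ∂μ, ∀ k, (S n ω k).PosSemidef)
    (hSZ : ∀ n, IndepFun (fun ω (x : Fin 2 × Fin (p n) × Fin (p n)) => S n ω x.1 x.2.1 x.2.2)
      (fun ω (x : Fin 2 × Fin (p n) × Fin n) => Z n ω x.1 x.2.1 x.2.2) μ)
    (hind : ∀ n, iIndepFun (fun (x : Fin 2 × Fin (p n) × Fin n) ω => Z n ω x.1 x.2.1 x.2.2) μ)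
    (hZ0 : ∀ n k i j, ∫ ω, Z n ω k i j ∂μ = 0) (hη : 0 < η)
    (hZ : (⨆ (n) (k) (i) (j), ∫⁻ ω, ‖Z n ω k i j‖ₑ ^ (2 + η) ∂μ) < ∞)
    (hS2 : ∀ᵐ ω ∂μ, ∀ k,
      IsBoundedUnder (· ≤ ·) atTop fun n => (p n : ℝ)⁻¹ * ((S n ω k) ^ 2).trace.re) (s : ℝ) :
    Tendsto (fun n => ∫ ω, resolventAsymmetry (s • commutatorMatrix (S n ω) (Z n ω)) ∂μ) atTop
      (𝓝 0) := by
  simp only [integral_resolventAsymmetry_commutatorMatrix_eq_of_indepFun (hS_meas _) (hZ_meas _)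
    (hSZ _)]
  have conditional_tendsto : ∀ᵐ ω ∂μ, Tendsto (fun n =>
      ∫ ω', resolventAsymmetry (s • commutatorMatrix (S n ω) (Z n ω')) ∂μ) atTop (𝓝 0) := by
    filter_upwards [ae_all_iff.2 hS, hS2] with ω hSω hS2ω
    exact tendsto_integral_resolventAsymmetry_commutatorMatrix hp hZ_meas hind hZ0 hη hZ hSω hS2ω s
  have joint_measurable (n : ℕ) : Measurable fun q : Ω × Ω =>
      resolventAsymmetry (s • commutatorMatrix (S n q.1) (Z n q.2)) :=
    measurable_resolventAsymmetry fun i j => (measurable_commutatorMatrix_apply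
      (fun k i j => (hS_meas n k i j).comp measurable_fst)
      (fun k i j => (hZ_meas n k i j).comp measurable_snd) i j).const_smul s
  simpa using tendsto_integral_of_dominated_convergence (fun _ => 2)
    (fun n => (joint_measurable n).stronglyMeasurable.integral_prod_right'.aestronglyMeasurable)
    (integrable_const _)
    (fun n => ae_of_all _ fun ω => by
      simpa using norm_integral_le_of_norm_le_const (μ := μ) (ae_of_all _ fun ω' =>
        norm_resolventAsymmetry_le_two (skewAdjoint.smul_mem s
          (commutatorMatrix_mem_skewAdjoint (S n ω) (Z n ω')))))
    conditional_tendsto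

end Asymptotics

theorem isBigO_natCast_of_tendsto_div {f : ℕ → ℝ} {c : ℝ}
    (h : Tendsto (fun n : ℕ => f n / n) atTop (𝓝 c)) : f =O[atTop] fun n => (n : ℝ) :=
  Asymptotics.isBigO_of_div_tendsto_nhds
    ((eventually_ne_atTop 0).mono fun _ hn h0 => absurd (Nat.cast_eq_zero.1 h0) hn) c h

theorem isBoundedUnder_le_of_limsup_coe_lt {ι : Type*} {l : Filter ι} {u : ι → ℝ} {b : ℝ}
    (h : limsup (fun i => (u i : EReal)) l < b) : IsBoundedUnder (· ≤ ·) l u :=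
  isBoundedUnder_of_eventually_le (a := b) <|
    (eventually_lt_of_limsup_lt h).mono fun _ hi => EReal.coe_le_coe_iff.1 hi.le

end RandomCommutator

theorem theorem4p5_general {Ω : Type*} [MeasurableSpace Ω] (μ : Measure Ω) [IsProbabilityMeasure μ]
    (p : ℕ → ℕ) (S : (n : ℕ) → Ω → Fin 2 → Matrix (Fin (p n)) (Fin (p n)) ℂ)
    (Z : (n : ℕ) → Ω → Fin 2 → Matrix (Fin (p n)) (Fin n) ℂ)
    (hS_meas : ∀ n k i j, Measurable fun ω => S n ω k i j)
    (hZ_meas : ∀ n k i j, Measurable fun ω => Z n ω k i j)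
    (hS : ∀ n, ∀ᵐ ω ∂μ, ∀ k, (S n ω k).PosSemidef)
    (hSZ : ∀ n, IndepFun (fun ω (x : Fin 2 × Fin (p n) × Fin (p n)) => S n ω x.1 x.2.1 x.2.2)
      (fun ω (x : Fin 2 × Fin (p n) × Fin n) => Z n ω x.1 x.2.1 x.2.2) μ)
    (hp : (fun n => (p n : ℝ)) =O[atTop] fun n => (n : ℝ))
    (hind : ∀ n, iIndepFun (fun (x : Fin 2 × Fin (p n) × Fin n) ω => Z n ω x.1 x.2.1 x.2.2) μ)
    (hZ0 : ∀ n k i j, ∫ ω, Z n ω k i j ∂μ = 0) (η : ℝ) (hη : 0 < η)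
    (hZ : (⨆ (n) (k) (i) (j), ∫⁻ ω, ‖Z n ω k i j‖ₑ ^ (2 + η) ∂μ) < ∞)
    (hS2 : ∀ᵐ ω ∂μ, ∀ k,
      IsBoundedUnder (· ≤ ·) atTop fun n => (p n : ℝ)⁻¹ * ((S n ω k) ^ 2).trace.re)
    (F : ProbabilityMeasure ℂ)
    (hF : RandomCommutator.IsLSD μ
      (fun n ω => RandomCommutator.commutatorMatrix (S n ω) (Z n ω)) F) :
    (F : Measure ℂ).map (fun z => -z) = (F : Measure ℂ) :=
  hF.map_neg_eq_self
    (fun n => RandomCommutator.measurable_commutatorMatrix_apply (hS_meas n) (hZ_meas n))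
    (fun _ _ => RandomCommutator.commutatorMatrix_mem_skewAdjoint _ _)
    (RandomCommutator.tendsto_integral_resolventAsymmetry_commutatorMatrix_of_indepFun hp hS_meas
      hZ_meas hS hSZ hind hZ0 hη hZ hS2)

theorem theorem4p5 {Ω : Type*} [MeasurableSpace Ω] (μ : Measure Ω) [IsProbabilityMeasure μ]
    -- the dimension `p n`; at stage `n` the `k`-th scaling matrix is `S n ω k`,
    -- and the `k`-th innovation matrix is `Z n ω k`
    (p : ℕ → ℕ) (c : ℝ)
    (S : (n : ℕ) → Ω → Fin 2 → Matrix (Fin (p n)) (Fin (p n)) ℂ)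
    (Z : (n : ℕ) → Ω → Fin 2 → Matrix (Fin (p n)) (Fin n) ℂ)
    (hSmeas : ∀ n k i j, Measurable fun ω => S n ω k i j)
    (hZmeas : ∀ n k i j, Measurable fun ω => Z n ω k i j)
    -- the scaling matrices are positive semi-definite and independent of the innovations
    (hSpsd : ∀ n, ∀ᵐ ω ∂μ, ∀ k, (S n ω k).PosSemidef)
    (hSZ : ∀ n, IndepFun
      (fun ω (x : Fin 2 × Fin (p n) × Fin (p n)) => S n ω x.1 x.2.1 x.2.2)
      (fun ω (x : Fin 2 × Fin (p n) × Fin n) => Z n ω x.1 x.2.1 x.2.2) μ)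
    -- `p / n` converges to `c` in `(0, ∞)`
    (hc : 0 < c)
    (hT1 : Tendsto (fun n : ℕ => (p n : ℝ) / (n : ℝ)) atTop (𝓝 c))
    -- independent entries, zero mean, unit variance, uniformly bounded moment of order `2 + η₀`
    (hT2indep : ∀ n, iIndepFun
      (fun (x : Fin 2 × Fin (p n) × Fin n) ω => Z n ω x.1 x.2.1 x.2.2) μ)
    (hT2mean : ∀ n k i j, ∫ ω, Z n ω k i j ∂μ = 0)
    (hT2var : ∀ n k i j, ∫ ω, ‖Z n ω k i j‖ ^ 2 ∂μ = 1)
    (η₀ : ℝ) (hη₀ : 0 < η₀)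
    (hT2mom : (⨆ (n) (k) (i) (j), ∫⁻ ω, ‖Z n ω k i j‖ₑ ^ (2 + η₀) ∂μ) < ∞)
    -- the scaling matrices commute
    (hT3 : ∀ n, ∀ᵐ ω ∂μ, S n ω 0 * S n ω 1 = S n ω 1 * S n ω 0)
    -- the joint spectral distributions converge weakly a.s. to a non-random `H` on the closed
    -- quadrant, whose support is contained in neither of the two coordinate axes
    (H : ProbabilityMeasure (ℝ × ℝ))
    (hHquad : (H : Measure (ℝ × ℝ)) {x | 0 ≤ x.1 ∧ 0 ≤ x.2}ᶜ = 0)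
    (hHfst : (H : Measure (ℝ × ℝ)) {x | x.1 ≠ 0} ≠ 0)
    (hHsnd : (H : Measure (ℝ × ℝ)) {x | x.2 ≠ 0} ≠ 0)
    (hT4 : ∀ᵐ ω ∂μ, Tendsto (fun n => RandomCommutator.jesd (S n ω 0) (S n ω 1)) atTop
      (𝓝 H.toFiniteMeasure))
    -- bounded second spectral moments; the limsup is taken in the extended reals
    (D₀ : ℝ) (hD₀ : 0 < D₀)
    (hT5 : ∀ᵐ ω ∂μ, ∀ k,
      limsup (fun n => (((p n : ℝ)⁻¹ * ((S n ω k) ^ 2).trace.re : ℝ) : EReal)) atTop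
        < (D₀ : EReal))
    -- `F` is the limiting spectral distribution of the commutator matrices
    (F : ProbabilityMeasure ℂ)
    (hF : RandomCommutator.IsLSD μ
      (fun n ω => RandomCommutator.commutatorMatrix (S n ω) (Z n ω)) F) :
    -- `F` is invariant under the reflection `z ↦ -z`
    (F : Measure ℂ).map (fun z => -z) = (F : Measure ℂ) := by
  exact theorem4p5_general μ p S Z hSmeas hZmeas hSpsd hSZ
    (RandomCommutator.isBigO_natCast_of_tendsto_div hT1) hT2indep hT2mean η₀ hη₀ hT2mom
    (hT5.mono fun _ h k => RandomCommutator.isBoundedUnder_le_of_limsup_coe_lt (h k)) F hF
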